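/- Let $H_n=\mathbb C^n\times\mathbb R$ be the Heisenberg group with contact form $\Theta=dt+\sum_\beta (x_\beta\,dy_\beta-y_\beta\,dx_\beta)$, Reeb field $T=\partial_t$, its standard CR structure $J$ on $\ker\Theta$, and the adapted metric for which the fields $\partial_{x_\beta}+y_\beta\partial_t$, $\partial_{y_\beta}-x_\beta\partial_t$, $T$ are orthonormal. Let $m\ge 1$ and $n=m+1$, and let $(M,\hat J,\hat\theta)$ be a simply connected $(2m+1)$-dimensional pseudohermitian submanifold of $H_n$, i.e. a pseudohermitian manifold with an immersion $f:M\to H_n$ such that $\hat\theta=f^*\Theta$ and $df\circ\hat J=J\circ df$ on $\ker\hat\theta$. Let $\nu$ be its fundamental vector field: the unique horizontal field along $M$ orthogonal to $df(\ker\hat\theta)$ for which $T+\nu$ is tangent to $M$. Let its second fundamental form $II$ be the part normal to $M$ of $\nabla_YX$, for $X,Y$ in the $(1,0)$-part of $\ker\hat\theta\otimes\mathbb C$, where $\nabla$ is the pseudohermitian connection of $H_n$. Suppose that $\nu$ is nowhere zero. Then the pseudohermitian (Tanaka–Webster) torsion of $(M,\hat J,\hat\theta)$ vanishes identically if and only if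 $II$ vanishes identically. If this is the case, then $|\nu|$ (the length for the adapted metric) is a positive constant, the Webster scalar curvature of $(M,\hat J,\hat\theta)$ (with respect to unitary admissible coframes, $d\hat\theta=i\sum_k\theta^k\wedge\theta^{\bar k}$) is the constant $m(m+1)|\nu|^2$, and after a Heisenberg rigid motion (a left translation composed with a unitary rotation about the $t$-axis) $M$ is an open part of the standard sphere $$S^{2m+1}(r)=\{(z,0)\in\mathbb C^n\times\{0\} : |z|=r\},\qquad r=\frac1{|\nu|};$$ that is, there is a rigid motion $\Phi$ such that $\Phi\circ f$ is a local homeomorphism into $S^{2m+1}(r)$, and an open embedding into it if $f$ is injective. -/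

import Mathlib

open Set Filter Topology
open scoped Manifold ContDiff ComplexConjugate

noncomputable section

/-! ### The Heisenberg group -/

/-- The Heisenberg group `H_n = ℂⁿ × ℝ`, with points `(z, t)`, `z = x + i y`. It is a real vector
space, and every tangent space is identified with it. -/
abbrev Heis (n : ℕ) : Type := EuclideanSpace ℂ (Fin n) × ℝ

namespace Heis

variable {n : ℕ}

/-- The group law `(x,y,t) ∘ (x',y',t') = (x + x', y + y', t + t' + y x' - x y')`. -/
def mul (p q : Heis n) : Heis n := (p.1 + q.1, p.2 + q.2 - (inner ℂ p.1 q.1).im)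

/-- The standard contact form `Θ = dt + ∑ (x dy - y dx)` at `q`, evaluated on `v`. -/
def Θ (q v : Heis n) : ℝ := v.2 + (inner ℂ q.1 v.1).im

/-- The Reeb vector field `T = ∂/∂t`. -/
def T : Heis n := (0, 1)

/-- The horizontal vector at `q` with `ℂⁿ`-component `w = a + i b`, that is `∑ a_β e_β + b_β e_{n+β}`
with `e_β = ∂/∂x_β + y_β ∂/∂t` and `e_{n+β} = ∂/∂y_β - x_β ∂/∂t`. -/
def hlift (q : Heis n) (w : EuclideanSpace ℂ (Fin n)) : Heis n := (w, -(inner ℂ q.1 w).im)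

/-- The standard CR structure: `J e_β = e_{n+β}`, `J e_{n+β} = - e_β` (and `J T = 0`). -/
def J (q v : Heis n) : Heis n := hlift q (Complex.I • v.1)

/-- The adapted metric at `q`, for which `e_β, e_{n+β}, T` are orthonormal. -/
def metric (q v w : Heis n) : ℝ := (inner ℂ v.1 w.1).re + Θ q v * Θ q w

/-- The length of a tangent vector at `q` for the adapted metric. -/
def length (q v : Heis n) : ℝ := Real.sqrt (metric q v v)

/-- Heisenberg rigid motions: compositions of a left translation with a unitary rotation around the
`t`-axis. -/
def IsRigidMotion (Φ : Heis n → Heis n) : Prop :=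
  ∃ (p : Heis n) (U : EuclideanSpace ℂ (Fin n) ≃ₗᵢ[ℂ] EuclideanSpace ℂ (Fin n)),
    ∀ q, Φ q = mul p (U q.1, q.2)

/-- The standard sphere of radius `r` in `ℂⁿ × {0}`. -/
def sphere (n : ℕ) (r : ℝ) : Set (Heis n) := {q | ‖q.1‖ = r ∧ q.2 = 0}

end Heis

/-! ### One-forms on a real vector space -/

section Forms

variable {E F : Type*} [NormedAddCommGroup E] [NormedSpace ℝ E] [NormedAddCommGroup F]
  [NormedSpace ℝ F]

/-- The exterior derivative `dα (v, w)` of a one-form. -/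
def dForm (α : E → E →L[ℝ] F) (x v w : E) : F := fderiv ℝ α x v w - fderiv ℝ α x w v

/-- The wedge product of two complex covectors, evaluated on `(v, w)`. -/
def wedge (a b : E →L[ℝ] ℂ) (v w : E) : ℂ := a v * b w - a w * b v

/-- The complex conjugate of a complex covector. -/
def conjForm (a : E →L[ℝ] ℂ) : E →L[ℝ] ℂ := (Complex.conjCLE : ℂ →L[ℝ] ℂ).comp a

/-- A real covector as a complex one. -/
def toComplexForm (a : E →L[ℝ] ℝ) : E →L[ℝ] ℂ := Complex.ofRealCLM.comp a

end Forms

/-! ### Pseudohermitian manifolds -/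

/-- The model space of manifolds of CR dimension `m`. -/
abbrev PHModel (m : ℕ) : Type := EuclideanSpace ℝ (Fin (2 * m + 1))

section Charts

variable {m : ℕ} {M : Type*} [TopologicalSpace M] [ChartedSpace (PHModel m) M]

/-- A one-form on `M`, read in the chart `e`. -/
def formInChart (e : OpenPartialHomeomorph M (PHModel m))
    (α : ∀ p : M, TangentSpace 𝓘(ℝ, PHModel m) p →L[ℝ] ℝ) :
    PHModel m → PHModel m →L[ℝ] ℝ := fun x =>
  (α (e.symm x)).comp (mfderiv 𝓘(ℝ, PHModel m) 𝓘(ℝ, PHModel m) e.symm x)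

/-- A field of endomorphisms of the tangent spaces of `M`, read in the chart `e`. -/
def endoInChart (e : OpenPartialHomeomorph M (PHModel m))
    (J : ∀ p : M, TangentSpace 𝓘(ℝ, PHModel m) p →L[ℝ] TangentSpace 𝓘(ℝ, PHModel m) p) :
    PHModel m → PHModel m →L[ℝ] PHModel m := fun x =>
  (mfderiv 𝓘(ℝ, PHModel m) 𝓘(ℝ, PHModel m) e (e.symm x)).comp
    ((J (e.symm x)).comp (mfderiv 𝓘(ℝ, PHModel m) 𝓘(ℝ, PHModel m) e.symm x))

end Charts

/-- A (strictly pseudoconvex) pseudohermitian structure on a `(2m+1)`-dimensional manifold: a contact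
form `θ` and an integrable CR structure `J` on `ker θ` with positive Levi form `dθ (·, J ·)`. As
usual `J` is extended to the whole tangent space by zero on the Reeb direction. -/
structure PseudohermitianStructure (m : ℕ) (M : Type*) [TopologicalSpace M]
    [ChartedSpace (PHModel m) M] [IsManifold 𝓘(ℝ, PHModel m) ∞ M] where
  θ : ∀ p : M, TangentSpace 𝓘(ℝ, PHModel m) p →L[ℝ] ℝ
  J : ∀ p : M, TangentSpace 𝓘(ℝ, PHModel m) p →L[ℝ] TangentSpace 𝓘(ℝ, PHModel m) p
  smooth_θ : ∀ e ∈ IsManifold.maximalAtlas 𝓘(ℝ, PHModel m) ∞ M,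
    ContDiffOn ℝ ∞ (formInChart e θ) e.target
  smooth_J : ∀ e ∈ IsManifold.maximalAtlas 𝓘(ℝ, PHModel m) ∞ M,
    ContDiffOn ℝ ∞ (endoInChart e J) e.target
  θ_ne_zero : ∀ p, θ p ≠ 0
  θ_J : ∀ p v, θ p (J p v) = 0
  J_J : ∀ p v, θ p v = 0 → J p (J p v) = -v
  J_reeb : ∀ e ∈ IsManifold.maximalAtlas 𝓘(ℝ, PHModel m) ∞ M, ∀ x ∈ e.target, ∀ v,
    (∀ w, dForm (formInChart e θ) x v w = 0) → endoInChart e J x v = 0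
  levi_pos : ∀ e ∈ IsManifold.maximalAtlas 𝓘(ℝ, PHModel m) ∞ M, ∀ x ∈ e.target, ∀ v,
    formInChart e θ x v = 0 → v ≠ 0 → 0 < dForm (formInChart e θ) x v (endoInChart e J x v)
  /-- The bundle spanned by the vector fields `X - i J X`, `X ∈ ker θ`, is involutive. -/
  integrable : ∀ e ∈ IsManifold.maximalAtlas 𝓘(ℝ, PHModel m) ∞ M,
    ∀ V : Set (PHModel m), IsOpen V → V ⊆ e.target → ∀ X Y : PHModel m → PHModel m,
    ContDiffOn ℝ ∞ X V → ContDiffOn ℝ ∞ Y V →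
    (∀ x ∈ V, formInChart e θ x (X x) = 0) → (∀ x ∈ V, formInChart e θ x (Y x) = 0) →
    ∀ x ∈ V,
      let JX : PHModel m → PHModel m := fun y => endoInChart e J y (X y)
      let JY : PHModel m → PHModel m := fun y => endoInChart e J y (Y y)
      let B := VectorField.lieBracket ℝ X Y x - VectorField.lieBracket ℝ JX JY x
      formInChart e θ x B = 0 ∧
        endoInChart e J x B = VectorField.lieBracket ℝ JX Y x + VectorField.lieBracket ℝ X JY x

/-! ### Connection, torsion and curvature, in coordinates -/

section Coframes

variable {m : ℕ}

/-- `ϑ¹, …, ϑᵐ` is a unitary admissible coframe on `V` for the structure `(θ, J)`: the `ϑʲ` are of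
type `(1,0)`, together with `θ` they form a coframe, and `dθ = i ∑ ϑᵏ ∧ ϑ^{k̄}` (in particular the
`ϑʲ` vanish on the Reeb field). -/
structure IsAdmissibleCoframe (V : Set (PHModel m)) (θ : PHModel m → PHModel m →L[ℝ] ℝ)
    (J : PHModel m → PHModel m →L[ℝ] PHModel m)
    (ϑ : Fin m → PHModel m → PHModel m →L[ℝ] ℂ) : Prop where
  smooth : ∀ j, ContDiffOn ℝ ∞ (ϑ j) V
  type_one_zero : ∀ x ∈ V, ∀ j v, θ x v = 0 → ϑ j x (J x v) = Complex.I * ϑ j x v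
  coframe : ∀ x ∈ V, ∀ v, θ x v = 0 → (∀ j, ϑ j x v = 0) → v = 0
  levi : ∀ x ∈ V, ∀ v w,
    ((dForm θ x v w : ℝ) : ℂ) = Complex.I * ∑ k, wedge (ϑ k x) (conjForm (ϑ k x)) v w

/-- The torsion forms `τʲ = ∑ Aʲ_{k̄} ϑ^{k̄}`. -/
def torsionForm (ϑ : Fin m → PHModel m → PHModel m →L[ℝ] ℂ) (A : Fin m → Fin m → PHModel m → ℂ)
    (j : Fin m) (x : PHModel m) : PHModel m →L[ℝ] ℂ :=
  ∑ k, A j k x • conjForm (ϑ k x)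

/-- `φ k j = θ_k{}^j` are the pseudohermitian (Tanaka-Webster) connection forms and `A j k = Aʲ_{k̄}`
the coefficients of the pseudohermitian torsion for the coframe `ϑ`:
`θ_k{}^j + θ_{j̄}{}^{k̄} = 0` and `dϑʲ = ∑ ϑᵏ ∧ θ_k{}^j + θ ∧ τʲ`. -/
structure IsConnection (V : Set (PHModel m)) (θ : PHModel m → PHModel m →L[ℝ] ℝ)
    (ϑ : Fin m → PHModel m → PHModel m →L[ℝ] ℂ)
    (φ : Fin m → Fin m → PHModel m → PHModel m →L[ℝ] ℂ)
    (A : Fin m → Fin m → PHModel m → ℂ) : Prop where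
  smooth_φ : ∀ k j, ContDiffOn ℝ ∞ (φ k j) V
  smooth_A : ∀ j k, ContDiffOn ℝ ∞ (A j k) V
  skew : ∀ x ∈ V, ∀ k j, φ k j x + conjForm (φ j k x) = 0
  structure_eq : ∀ x ∈ V, ∀ j v w,
    dForm (ϑ j) x v w = ∑ k, wedge (ϑ k x) (φ k j x) v w
      + wedge (toComplexForm (θ x)) (torsionForm ϑ A j x) v w

/-- `R k j p q = R_k{}^j{}_{p q̄}` are the coefficients of the Webster curvature tensor: modulo `θ`,
`dθ_k{}^j - ∑ θ_k{}^l ∧ θ_l{}^j = ∑ R_k{}^j{}_{p q̄} ϑᵖ ∧ ϑ^{q̄} + i ϑ^{k̄} ∧ τʲ - i τ^{k̄} ∧ ϑʲ`. -/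
def IsCurvature (V : Set (PHModel m)) (θ : PHModel m → PHModel m →L[ℝ] ℝ)
    (ϑ : Fin m → PHModel m → PHModel m →L[ℝ] ℂ)
    (φ : Fin m → Fin m → PHModel m → PHModel m →L[ℝ] ℂ)
    (A : Fin m → Fin m → PHModel m → ℂ)
    (R : Fin m → Fin m → Fin m → Fin m → PHModel m → ℂ) : Prop :=
  ∀ x ∈ V, ∀ k j v w, θ x v = 0 → θ x w = 0 →
    dForm (φ k j) x v w - ∑ l, wedge (φ k l x) (φ l j x) v w =
      ∑ p, ∑ q, R k j p q x * wedge (ϑ p x) (conjForm (ϑ q x)) v w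
        + Complex.I * wedge (conjForm (ϑ k x)) (torsionForm ϑ A j x) v w
        - Complex.I * wedge (conjForm (torsionForm ϑ A k x)) (ϑ j x) v w

end Coframes

section Invariants

variable {m : ℕ} {M : Type*} [TopologicalSpace M] [ChartedSpace (PHModel m) M]
  [IsManifold 𝓘(ℝ, PHModel m) ∞ M]

/-- The pseudohermitian torsion vanishes identically: its coefficients with respect to every local
unitary admissible coframe are zero. -/
def TorsionVanishes (S : PseudohermitianStructure m M) : Prop :=
  ∀ e ∈ IsManifold.maximalAtlas 𝓘(ℝ, PHModel m) ∞ M,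
    ∀ V : Set (PHModel m), IsOpen V → V ⊆ e.target → ∀ ϑ φ A,
      IsAdmissibleCoframe V (formInChart e S.θ) (endoInChart e S.J) ϑ →
      IsConnection V (formInChart e S.θ) ϑ φ A →
      ∀ x ∈ V, ∀ j k, A j k x = 0

/-- `r` is the value at `p` of the Webster (scalar) curvature `R = ∑ R_k{}^k{}_{l l̄}`. -/
def IsWebsterCurvatureAt (S : PseudohermitianStructure m M) (p : M) (r : ℝ) : Prop :=
  ∃ e ∈ IsManifold.maximalAtlas 𝓘(ℝ, PHModel m) ∞ M, p ∈ e.source ∧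
    ∃ V : Set (PHModel m), IsOpen V ∧ V ⊆ e.target ∧ e p ∈ V ∧ ∃ ϑ φ A R,
      IsAdmissibleCoframe V (formInChart e S.θ) (endoInChart e S.J) ϑ ∧
      IsConnection V (formInChart e S.θ) ϑ φ A ∧
      IsCurvature V (formInChart e S.θ) ϑ φ A R ∧
      (r : ℂ) = ∑ k, ∑ l, R k k l l (e p)

/-! ### Pseudohermitian submanifolds of the Heisenberg group -/

variable {n : ℕ}

/-- The differential of `f : M → H_n` at `p`. -/
def diffAt (f : M → Heis n) (p : M) : TangentSpace 𝓘(ℝ, PHModel m) p →L[ℝ] Heis n :=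
  mfderiv 𝓘(ℝ, PHModel m) 𝓘(ℝ, Heis n) f p

/-- `(M, J, θ)`, immersed by `f`, is a pseudohermitian submanifold of `H_n`: `θ` is the restriction
of `Θ` (so that `ker θ = TM ∩ ker Θ`) and `J` is, on `ker θ`, the restriction of the standard CR
structure. -/
structure IsPseudohermitianSubmanifold (S : PseudohermitianStructure m M) (f : M → Heis n) :
    Prop where
  smooth : ContMDiff 𝓘(ℝ, PHModel m) 𝓘(ℝ, Heis n) ∞ f
  immersion : ∀ p : M, Function.Injective (diffAt (m := m) f p)
  θ_eq : ∀ (p : M) (v : TangentSpace 𝓘(ℝ, PHModel m) p), S.θ p v = Heis.Θ (f p) (diffAt f p v)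
  J_eq : ∀ (p : M) (v : TangentSpace 𝓘(ℝ, PHModel m) p), S.θ p v = 0 → diffAt f p (S.J p v) = Heis.J (f p) (diffAt f p v)

/-- `ν` is the fundamental vector field: `ν` is horizontal, orthogonal to `ker θ`, and `T + ν` is
tangent to `M`. -/
def IsFundamentalVectorField (S : PseudohermitianStructure m M) (f : M → Heis n)
    (ν : M → Heis n) : Prop :=
  ∀ p : M, Heis.Θ (f p) (ν p) = 0 ∧
    (∀ v : TangentSpace 𝓘(ℝ, PHModel m) p, S.θ p v = 0 → Heis.metric (f p) (ν p) (diffAt f p v) = 0) ∧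
    ∃ u : TangentSpace 𝓘(ℝ, PHModel m) p, diffAt f p u = Heis.T + ν p

/-- The holomorphic tangent space of `M` at `p`, that is the space of all `w ∈ ℂⁿ` such that
`∑ w_β Z_β` is tangent to `M`, where `Z_β = (e_β - i e_{n+β}) / 2`. -/
def holTangent (S : PseudohermitianStructure m M) (f : M → Heis n) (p : M) :
    Submodule ℂ (EuclideanSpace ℂ (Fin n)) :=
  Submodule.span ℂ {w | ∃ v : TangentSpace 𝓘(ℝ, PHModel m) p, S.θ p v = 0 ∧ w = (diffAt f p v).1}

/-- The second fundamental form at `p`. Let `W` be a section of the holomorphic tangent bundle (the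
field `∑ W_β Z_β`) and `v ∈ ker θ`, and put `Y = (v - i J v) / 2`. The value is the normal part of
`∇_Y W = ∑ (Y W_β) Z_β`, where `∇` is the pseudohermitian connection of `H_n`, for which the `Z_β` are
parallel. -/
def secondFundamentalForm (S : PseudohermitianStructure m M) (f : M → Heis n) (p : M)
    (v : TangentSpace 𝓘(ℝ, PHModel m) p) (W : M → EuclideanSpace ℂ (Fin n)) :
    EuclideanSpace ℂ (Fin n) :=
  let dW : TangentSpace 𝓘(ℝ, PHModel m) p →L[ℝ] EuclideanSpace ℂ (Fin n) :=
    mfderiv 𝓘(ℝ, PHModel m) 𝓘(ℝ, EuclideanSpace ℂ (Fin n)) W p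
  (holTangent S f p)ᗮ.starProjection ((1 / 2 : ℂ) • (dW v - Complex.I • dW (S.J p v)))

/-- The second fundamental form vanishes identically. -/
def SecondFundamentalFormVanishes (S : PseudohermitianStructure m M) (f : M → Heis n) : Prop :=
  ∀ (U : Set M) (W : M → EuclideanSpace ℂ (Fin n)), IsOpen U →
    ContMDiffOn 𝓘(ℝ, PHModel m) 𝓘(ℝ, EuclideanSpace ℂ (Fin n)) ∞ W U →
    (∀ q ∈ U, W q ∈ holTangent S f q) →
    ∀ p ∈ U, ∀ v, S.θ p v = 0 → secondFundamentalForm S f p v W = 0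

end Invariants

end

/-!
In a chart, the `ℂⁿ`-component `z` of `f` immerses `M` as a real hypersurface, and the field
`w = dz ξ`, with `ξ` the Reeb field, is the `ℂⁿ`-component of `ν` and spans the complex orthogonal
complement of `dz (ker θ)`. The Gauss formula along a unitary frame `g` of that complement exhibits
`⟪g j, dg k⟫ - i ‖w‖² θ δ` as the Tanaka–Webster connection forms. Hence the torsion, like the
second fundamental form, is the `(0,1)`-part of `dw` on `ker θ`, which gives the equivalence.

If this part vanishes, then `dw = i ‖w‖² dz` on `ker θ` up to multiples of `w`. Differentiating
once more, a Codazzi equation shows that `‖w‖` is constant along `ker θ`; since `ker θ` is a contact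
distribution, `‖w‖` is constant, and by the same argument so is `w - i ‖w‖² z`. This puts `z` on a
sphere of radius `1 / ‖w‖` about a centre `z₀`, with `t + Im ⟪z₀, z⟫` constant, so that the left
translation by `(-z₀, -τ)`, for `τ` the value of that constant, maps `M` into the standard sphere.
-/

noncomputable section

open scoped InnerProductSpace

section ExteriorCalculus

variable {E : Type*} [NormedAddCommGroup E] [NormedSpace ℝ E]
  {F : Type*} [NormedAddCommGroup F] [NormedSpace ℝ F]
  {W : Type*} [NormedAddCommGroup W] [InnerProductSpace ℂ W] [NormedSpace ℝ W]
  {V : Set E} {x : E}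

theorem differentiableAt_of_contDiffOn {φ : E → F} (hφ : ContDiffOn ℝ ∞ φ V) (hV : IsOpen V)
    (hx : x ∈ V) : DifferentiableAt ℝ φ x :=
  (hφ.contDiffAt (hV.mem_nhds hx)).differentiableAt (by simp)

theorem contDiffOn_fderiv {φ : E → F} (hV : IsOpen V) (hφ : ContDiffOn ℝ ∞ φ V) :
    ContDiffOn ℝ ∞ (fderiv ℝ φ) V :=
  hφ.fderiv_of_isOpen hV (by simp)

theorem dForm_congr {α β : E → E →L[ℝ] F} (h : α =ᶠ[𝓝 x] β) (u v : E) :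
    dForm α x u v = dForm β x u v := by
  simp only [dForm, h.fderiv_eq]

theorem dForm_add {α β : E → E →L[ℝ] F} (hα : DifferentiableAt ℝ α x)
    (hβ : DifferentiableAt ℝ β x) (u v : E) :
    dForm (fun y => α y + β y) x u v = dForm α x u v + dForm β x u v := by
  simp only [dForm, fderiv_fun_add hα hβ, add_apply]
  abel

theorem dForm_sub {α β : E → E →L[ℝ] F} (hα : DifferentiableAt ℝ α x)
    (hβ : DifferentiableAt ℝ β x) (u v : E) :
    dForm (fun y => α y - β y) x u v = dForm α x u v - dForm β x u v := by
  simp only [dForm, fderiv_fun_sub hα hβ, sub_apply]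
  abel

theorem dForm_smul {𝕜 : Type*} [NontriviallyNormedField 𝕜] [NormedAlgebra ℝ 𝕜] [NormedSpace 𝕜 F]
    [IsScalarTower ℝ 𝕜 F] {c : E → 𝕜} {α : E → E →L[ℝ] F} (hc : DifferentiableAt ℝ c x)
    (hα : DifferentiableAt ℝ α x) (u v : E) :
    dForm (fun y => c y • α y) x u v
      = c x • dForm α x u v + (fderiv ℝ c x u • α x v - fderiv ℝ c x v • α x u) := by
  simp only [dForm, fderiv_fun_smul hc hα, add_apply,
    smul_apply, ContinuousLinearMap.smulRight_apply, smul_sub]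
  abel

theorem dForm_smulRight {θ : E → E →L[ℝ] ℝ} {κ : E → F} (hθ : DifferentiableAt ℝ θ x)
    (hκ : DifferentiableAt ℝ κ x) (u v : E) :
    dForm (fun y => (θ y).smulRight (κ y)) x u v
      = dForm θ x u v • κ x + (θ x v • fderiv ℝ κ x u - θ x u • fderiv ℝ κ x v) := by
  have h : HasFDerivAt (fun y => (θ y).smulRight (κ y)) _ x :=
    (ContinuousLinearMap.smulRightL ℝ E F).hasFDerivAt_of_bilinear hθ.hasFDerivAt hκ.hasFDerivAt
  simp only [dForm, h.fderiv, add_apply, ContinuousLinearMap.precompR_apply,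
    ContinuousLinearMap.precompL_apply, ContinuousLinearMap.compL_apply,
    ContinuousLinearMap.comp_apply, ContinuousLinearMap.smulRightL_apply_apply,
    ContinuousLinearMap.smulRight_apply, sub_smul]
  abel

theorem dForm_clm_comp {G : Type*} [NormedAddCommGroup G] [NormedSpace ℝ G] (L : F →L[ℝ] G)
    {α : E → E →L[ℝ] F} (hα : DifferentiableAt ℝ α x) (u v : E) :
    dForm (fun y => L.comp (α y)) x u v = L (dForm α x u v) := by
  have h : fderiv ℝ (fun y => L.comp (α y)) x = (ContinuousLinearMap.compL ℝ E F G L).comp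
      (fderiv ℝ α x) :=
    ((ContinuousLinearMap.compL ℝ E F G L).hasFDerivAt.comp x hα.hasFDerivAt).fderiv
  simp only [dForm, h, ContinuousLinearMap.comp_apply, ContinuousLinearMap.compL_apply, map_sub]

theorem dForm_toComplexForm {θ : E → E →L[ℝ] ℝ} (hθ : DifferentiableAt ℝ θ x) (u v : E) :
    dForm (fun y => toComplexForm (θ y)) x u v = ((dForm θ x u v : ℝ) : ℂ) :=
  dForm_clm_comp Complex.ofRealCLM hθ u v

theorem dForm_fderiv {φ : E → F} (hφ : ContDiffAt ℝ 2 φ x) (u v : E) :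
    dForm (fderiv ℝ φ) x u v = 0 :=
  sub_eq_zero.2 ((hφ.isSymmSndFDerivAt (by simp)).eq u v)

theorem inner_fderiv_of_const {a b : E → W} {c : ℂ} (ha : DifferentiableAt ℝ a x)
    (hb : DifferentiableAt ℝ b x) (h : ∀ᶠ y in 𝓝 x, ⟪a y, b y⟫_ℂ = c) (u : E) :
    ⟪fderiv ℝ a x u, b x⟫_ℂ = -⟪a x, fderiv ℝ b x u⟫_ℂ := by
  have h0 : fderiv ℝ (fun y => ⟪a y, b y⟫_ℂ) x u = 0 := by
    rw [Filter.EventuallyEq.fderiv_eq (f := fun _ => c) h, fderiv_const_apply]; rfl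
  rw [fderiv_inner_apply ℂ ha hb] at h0
  linear_combination h0

theorem ofReal_fderiv_norm_sq {w : E → W} (hw : DifferentiableAt ℝ w x) (u : E) :
    ((fderiv ℝ (fun y => ‖w y‖ ^ 2) x u : ℝ) : ℂ)
      = ⟪w x, fderiv ℝ w x u⟫_ℂ + ⟪fderiv ℝ w x u, w x⟫_ℂ := by
  have hn : DifferentiableAt ℝ (fun y => ‖w y‖ ^ 2) x := hw.norm_sq ℂ
  have hsq : (fun y => ⟪w y, w y⟫_ℂ) = fun y => Complex.ofRealCLM (‖w y‖ ^ 2) := by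
    funext y; simp [inner_self_eq_norm_sq_to_K]
  rw [← fderiv_inner_apply ℂ hw hw, hsq]
  exact (DFunLike.congr_fun (Complex.ofRealCLM.hasFDerivAt.comp x hn.hasFDerivAt).fderiv u).symm

theorem eq_zero_of_fderiv_eq_smulRight {φ κ : E → F} {θ : E → E →L[ℝ] ℝ}
    (hφ : ContDiffAt ℝ 2 φ x) (hθ : DifferentiableAt ℝ θ x) (hκ : DifferentiableAt ℝ κ x)
    (h : ∀ᶠ y in 𝓝 x, fderiv ℝ φ y = (θ y).smulRight (κ y)) {u v : E} (hu : θ x u = 0)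
    (hv : θ x v = 0) (huv : dForm θ x u v ≠ 0) : κ x = 0 := by
  have hd := dForm_smulRight hθ hκ u v
  rw [← dForm_congr h, dForm_fderiv hφ, hu, hv, zero_smul, zero_smul, sub_self, add_zero] at hd
  exact (smul_eq_zero.1 hd.symm).resolve_left huv

variable [IsScalarTower ℝ ℂ W]

variable (W) in
/-- The Hermitian inner product of `W` as a real bilinear map, conjugate-linear in the first
argument. -/
def innerCLM : W →L[ℝ] W →L[ℝ] ℂ :=
  (isBoundedBilinearMap_inner (𝕜 := ℂ) (E := W)).toContinuousLinearMap

/-- The complex-valued one-form `⟪g, dφ⟫_ℂ`. -/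
def innerForm (g φ : E → W) (x : E) : E →L[ℝ] ℂ :=
  (innerCLM W (g x)).comp (fderiv ℝ φ x)

@[simp]
theorem innerForm_apply (g φ : E → W) (x v : E) : innerForm g φ x v = ⟪g x, fderiv ℝ φ x v⟫_ℂ := rfl

theorem contDiffOn_innerForm {g φ : E → W} (hV : IsOpen V) (hg : ContDiffOn ℝ ∞ g V)
    (hφ : ContDiffOn ℝ ∞ φ V) : ContDiffOn ℝ ∞ (innerForm g φ) V :=
  ((innerCLM W).contDiff.comp_contDiffOn hg).clm_comp (contDiffOn_fderiv hV hφ)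

theorem dForm_innerForm {g φ : E → W} (hg : DifferentiableAt ℝ g x) (hφ : ContDiffAt ℝ 2 φ x)
    (u v : E) :
    dForm (innerForm g φ) x u v
      = ⟪fderiv ℝ g x u, fderiv ℝ φ x v⟫_ℂ - ⟪fderiv ℝ g x v, fderiv ℝ φ x u⟫_ℂ := by
  have hdφ : DifferentiableAt ℝ (fderiv ℝ φ) x :=
    (hφ.fderiv_right (m := 1) (by norm_num)).differentiableAt (by simp)
  have hD : fderiv ℝ (innerForm g φ) x = _ :=
    (((innerCLM W).hasFDerivAt.comp x hg.hasFDerivAt).clm_comp hdφ.hasFDerivAt).fderiv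
  have hsymm : fderiv ℝ (fderiv ℝ φ) x u v = fderiv ℝ (fderiv ℝ φ) x v u :=
    sub_eq_zero.1 (dForm_fderiv hφ u v)
  simp only [dForm, hD, add_apply, ContinuousLinearMap.comp_apply, Function.comp_apply,
    ContinuousLinearMap.compL_apply, ContinuousLinearMap.flip_apply, hsymm]
  exact add_sub_add_left_eq_sub _ _ _

end ExteriorCalculus

section LinearAlgebra

variable {E : Type*} [NormedAddCommGroup E] [NormedSpace ℝ E]
  {W : Type*} [NormedAddCommGroup W] [InnerProductSpace ℂ W]

theorem inner_self_eq_ofReal (a : W) : ⟪a, a⟫_ℂ = ((‖a‖ ^ 2 : ℝ) : ℂ) := by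
  rw [inner_self_eq_norm_sq_to_K, Complex.ofReal_pow]; rfl

variable [NormedSpace ℝ W] [IsScalarTower ℝ ℂ W]

variable {L : E →L[ℝ] W} {α : E →L[ℝ] ℝ} {w h : W}

theorem apply_eq_zero_of_add_smul_I_eq (hw : w ≠ 0)
    (hL : ∀ v, ⟪w, L v⟫_ℂ = ((‖w‖ ^ 2 * α v : ℝ) : ℂ)) (hh : ⟪w, h⟫_ℂ = 0) {v : E} {s : ℝ}
    (heq : L v + s • Complex.I • w = h) : α v = 0 ∧ s = 0 := by
  have hw' : ‖w‖ ≠ 0 := norm_ne_zero_iff.2 hw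
  rw [← heq, inner_add_right, hL, inner_smul_right_eq_smul, Complex.real_smul,
    inner_smul_right, inner_self_eq_ofReal, Complex.ext_iff] at hh
  simpa [← Complex.ofReal_pow, hw'] using hh

theorem exists_apply_eq_of_inner_eq_zero [FiniteDimensional ℝ E] (hw : w ≠ 0)
    (hL : ∀ v, ⟪w, L v⟫_ℂ = ((‖w‖ ^ 2 * α v : ℝ) : ℂ)) (hinj : ∀ v, L v = 0 → v = 0)
    (hdim : Module.finrank ℝ E + 1 = Module.finrank ℝ W) (hh : ⟪w, h⟫_ℂ = 0) :
    ∃ v, α v = 0 ∧ L v = h := by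
  have : FiniteDimensional ℝ W := Module.finite_of_finrank_pos (by omega)
  let A : E × ℝ →ₗ[ℝ] W := (L : E →ₗ[ℝ] W).coprod (LinearMap.toSpanSingleton ℝ W (Complex.I • w))
  have hA : Function.Injective A := by
    refine (injective_iff_map_eq_zero A).2 ?_
    rintro ⟨v, s⟩ (h0 : L v + s • Complex.I • w = 0)
    obtain ⟨-, rfl⟩ := apply_eq_zero_of_add_smul_I_eq hw hL (inner_zero_right _) h0
    rw [zero_smul, add_zero] at h0
    rw [hinj v h0, Prod.mk_zero_zero]
  obtain ⟨⟨v, s⟩, hv : L v + s • Complex.I • w = h⟩ :=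
    (LinearMap.injective_iff_surjective_of_finrank_eq_finrank
      (by rw [Module.finrank_prod, Module.finrank_self, hdim])).1 hA h
  obtain ⟨hv0, rfl⟩ := apply_eq_zero_of_add_smul_I_eq hw hL hh hv
  exact ⟨v, hv0, by rw [← hv, zero_smul, add_zero]⟩

end LinearAlgebra

section SmoothLinearSystems

variable {E : Type*} [NormedAddCommGroup E] [NormedSpace ℝ E]
  {F : Type*} [NormedAddCommGroup F] [NormedSpace ℝ F] [FiniteDimensional ℝ F]
  {G : Type*} [NormedAddCommGroup G] [NormedSpace ℝ G] [FiniteDimensional ℝ G]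
  {V : Set E} {A : E → F →L[ℝ] G} {b : E → G}

theorem isInvertible_of_apply_eq_zero {L : F →L[ℝ] G}
    (hdim : Module.finrank ℝ F = Module.finrank ℝ G) (hL : ∀ v, L v = 0 → v = 0) :
    L.IsInvertible :=
  ⟨(LinearEquiv.ofInjectiveOfFinrankEq (L : F →ₗ[ℝ] G) ((injective_iff_map_eq_zero _).2 hL)
    hdim).toContinuousLinearEquiv, rfl⟩

theorem exists_contDiffOn_apply_eq (hA : ContDiffOn ℝ ∞ A V) (hb : ContDiffOn ℝ ∞ b V)
    (hdim : Module.finrank ℝ F = Module.finrank ℝ G) (hinj : ∀ x ∈ V, ∀ v, A x v = 0 → v = 0) :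
    ∃ X : E → F, ContDiffOn ℝ ∞ X V ∧ ∀ x ∈ V, A x (X x) = b x := by
  have : CompleteSpace F := FiniteDimensional.complete ℝ F
  have hinv : ∀ x ∈ V, (A x).IsInvertible := fun x hx =>
    isInvertible_of_apply_eq_zero hdim (hinj x hx)
  refine ⟨fun x => (A x).inverse (b x), fun x hx => ?_,
    fun x hx => (hinv x hx).self_apply_inverse (b x)⟩
  exact ((hinv x hx).contDiffAt_map_inverse.comp_contDiffWithinAt x (hA x hx)).clm_apply (hb x hx)

theorem contDiffOn_of_apply_eq {X : E → F} (hA : ContDiffOn ℝ ∞ A V) (hb : ContDiffOn ℝ ∞ b V)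
    (hdim : Module.finrank ℝ F = Module.finrank ℝ G) (hinj : ∀ x ∈ V, ∀ v, A x v = 0 → v = 0)
    (hX : ∀ x ∈ V, A x (X x) = b x) : ContDiffOn ℝ ∞ X V := by
  obtain ⟨Y, hY, hAY⟩ := exists_contDiffOn_apply_eq hA hb hdim hinj
  refine hY.congr fun x hx => sub_eq_zero.1 (hinj x hx _ ?_)
  rw [map_sub, hX x hx, hAY x hx, sub_self]

end SmoothLinearSystems

/-- The `ℂⁿ`-component `z` of a pseudohermitian submanifold of the Heisenberg group in a chart: an
immersed real hypersurface whose contact form `θ` satisfies `dθ = 2 Im ⟪dz, dz⟫`, with Reeb field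
`ξ` and `w = dz ξ` orthogonal to the complex tangent spaces `dz (ker θ)`. -/
structure IsContactHypersurface {E : Type*} [NormedAddCommGroup E] [NormedSpace ℝ E]
    {W : Type*} [NormedAddCommGroup W] [InnerProductSpace ℂ W] [NormedSpace ℝ W]
    (V : Set E) (θ : E → E →L[ℝ] ℝ) (J : E → E →L[ℝ] E) (z w : E → W) (ξ : E → E) : Prop where
  isOpen : IsOpen V
  codim_one : Module.finrank ℝ E + 1 = Module.finrank ℝ W
  smooth_z : ContDiffOn ℝ ∞ z V
  smooth_θ : ContDiffOn ℝ ∞ θ V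
  smooth_J : ContDiffOn ℝ ∞ J V
  dθ : ∀ x ∈ V, ∀ u v, dForm θ x u v = 2 * (⟪fderiv ℝ z x u, fderiv ℝ z x v⟫_ℂ).im
  θ_ξ : ∀ x ∈ V, θ x (ξ x) = 1
  z_ξ : ∀ x ∈ V, fderiv ℝ z x (ξ x) = w x
  θ_J : ∀ x ∈ V, ∀ v, θ x v = 0 → θ x (J x v) = 0
  z_J : ∀ x ∈ V, ∀ v, θ x v = 0 → fderiv ℝ z x (J x v) = Complex.I • fderiv ℝ z x v
  orth : ∀ x ∈ V, ∀ v, θ x v = 0 → ⟪w x, fderiv ℝ z x v⟫_ℂ = 0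
  inj : ∀ x ∈ V, ∀ v, fderiv ℝ z x v = 0 → v = 0

/-- Twice the derivative of `w` in the direction of the `(0,1)`-part of `v`. -/
def dbar {E : Type*} [NormedAddCommGroup E] [NormedSpace ℝ E]
    {W : Type*} [NormedAddCommGroup W] [NormedSpace ℂ W] [NormedSpace ℝ W]
    (J : E → E →L[ℝ] E) (w : E → W) (x v : E) : W :=
  fderiv ℝ w x v + Complex.I • fderiv ℝ w x (J x v)

namespace IsContactHypersurface

variable {E : Type*} [NormedAddCommGroup E] [NormedSpace ℝ E]
  {W : Type*} [NormedAddCommGroup W] [InnerProductSpace ℂ W] [NormedSpace ℝ W]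
  {V : Set E} {θ : E → E →L[ℝ] ℝ} {J : E → E →L[ℝ] E} {z w : E → W} {ξ : E → E}
  (H : IsContactHypersurface V θ J z w ξ) {x : E} (hx : x ∈ V)

include H hx

section Basic

theorem eventually_mem : ∀ᶠ y in 𝓝 x, y ∈ V := H.isOpen.mem_nhds hx

theorem contDiffAt {F : Type*} [NormedAddCommGroup F] [NormedSpace ℝ F] {a : E → F}
    (ha : ContDiffOn ℝ ∞ a V) : ContDiffAt ℝ 2 a x :=
  (ha.contDiffAt (H.eventually_mem hx)).of_le (WithTop.coe_le_coe.2 le_top)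

theorem differentiableAt {F : Type*} [NormedAddCommGroup F] [NormedSpace ℝ F] {a : E → F}
    (ha : ContDiffOn ℝ ∞ a V) : DifferentiableAt ℝ a x :=
  (H.contDiffAt hx ha).differentiableAt (by simp)

theorem w_ne : w x ≠ 0 := fun h => by
  simpa [H.inj x hx (ξ x) ((H.z_ξ x hx).trans h)] using H.θ_ξ x hx

theorem norm_sq_ne : ((‖w x‖ ^ 2 : ℝ) : ℂ) ≠ 0 := by
  simpa using H.w_ne hx

theorem θ_sub_smul_ξ (v : E) : θ x (v - θ x v • ξ x) = 0 := by
  simp [H.θ_ξ x hx]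

theorem dz_sub_smul_ξ (v : E) :
    fderiv ℝ z x (v - θ x v • ξ x) = fderiv ℝ z x v - θ x v • w x := by
  rw [map_sub, map_smul, H.z_ξ x hx]

theorem ofReal_dθ (u v : E) : ((dForm θ x u v : ℝ) : ℂ)
    = -Complex.I * (⟪fderiv ℝ z x u, fderiv ℝ z x v⟫_ℂ - ⟪fderiv ℝ z x v, fderiv ℝ z x u⟫_ℂ) := by
  rw [H.dθ x hx, ← inner_conj_symm (fderiv ℝ z x v), Complex.sub_conj]
  push_cast
  linear_combination 2 * ((⟪fderiv ℝ z x u, fderiv ℝ z x v⟫_ℂ).im : ℂ) * Complex.I_sq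

theorem dθ_J {v : E} (hv : θ x v = 0) : dForm θ x v (J x v) = 2 * ‖fderiv ℝ z x v‖ ^ 2 := by
  rw [H.dθ x hx, H.z_J x hx v hv, inner_smul_right, inner_self_eq_ofReal]
  simp [-Complex.ofReal_pow]

variable [IsScalarTower ℝ ℂ W]

theorem inner_w_dz (v : E) : ⟪w x, fderiv ℝ z x v⟫_ℂ = ((‖w x‖ ^ 2 * θ x v : ℝ) : ℂ) := by
  have h := H.orth x hx _ (H.θ_sub_smul_ξ hx v)
  rw [H.dz_sub_smul_ξ hx, inner_sub_right, sub_eq_zero, inner_smul_right_eq_smul,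
    Complex.real_smul, inner_self_eq_ofReal] at h
  rw [h, mul_comm, Complex.ofReal_mul]

theorem dθ_ξ (v : E) : dForm θ x v (ξ x) = 0 := by
  rw [H.dθ x hx, H.z_ξ x hx, ← inner_conj_symm, H.inner_w_dz hx, Complex.conj_ofReal,
    Complex.ofReal_im, mul_zero]

omit hx in
theorem smooth_ξ [FiniteDimensional ℝ E] : ContDiffOn ℝ ∞ ξ V := by
  let K : E → E →L[ℝ] StrongDual ℝ E := fun x =>
    fderiv ℝ θ x - (fderiv ℝ θ x).flip + (θ x).smulRight (θ x)
  have hK_apply : ∀ x u v, K x u v = dForm θ x u v + θ x u * θ x v := fun _ _ _ => rfl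
  have hdθ := contDiffOn_fderiv H.isOpen H.smooth_θ
  have hK : ContDiffOn ℝ ∞ K V := by
    have hflip : ContDiffOn ℝ ∞ (fun x => (fderiv ℝ θ x).flip) V :=
      ContDiff.comp_contDiffOn (g := fun L => ContinuousLinearMap.flipₗᵢ ℝ E E ℝ L)
        (LinearIsometryEquiv.contDiff _) hdθ
    exact (hdθ.sub hflip).add (H.smooth_θ.smulRight H.smooth_θ)
  refine contDiffOn_of_apply_eq hK H.smooth_θ
    (Subspace.dual_finrank_eq.symm.trans LinearMap.toContinuousLinearMap.finrank_eq)
    (fun x hx v hv => ?_) fun x hx => ?_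
  · have hθv : θ x v = 0 := by
      simpa [hK_apply, H.dθ_ξ hx, H.θ_ξ x hx] using DFunLike.congr_fun hv (ξ x)
    have hJv : dForm θ x v (J x v) = 0 := by
      simpa [hK_apply, hθv] using DFunLike.congr_fun hv (J x v)
    rw [H.dθ_J hx hθv] at hJv
    exact H.inj x hx v (by simpa using hJv)
  · ext v
    have hξv : dForm θ x (ξ x) v = 0 := by
      rw [dForm, ← neg_sub, neg_eq_zero]; exact H.dθ_ξ hx v
    rw [hK_apply, hξv, H.θ_ξ x hx, zero_add, one_mul]

omit hx in
theorem smooth_w [FiniteDimensional ℝ E] : ContDiffOn ℝ ∞ w V :=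
  ((contDiffOn_fderiv H.isOpen H.smooth_z).clm_apply H.smooth_ξ).congr
    fun x hx => (H.z_ξ x hx).symm

theorem surj [FiniteDimensional ℝ E] {h : W} (hh : ⟪w x, h⟫_ℂ = 0) :
    ∃ v, θ x v = 0 ∧ fderiv ℝ z x v = h :=
  exists_apply_eq_of_inner_eq_zero (H.w_ne hx) (H.inner_w_dz hx) (H.inj x hx) H.codim_one hh

end Basic

section SecondOrder

variable [IsScalarTower ℝ ℂ W] [FiniteDimensional ℝ E]

/- The exterior derivative of `⟪w, dz⟫ = ‖w‖² θ`. -/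
theorem inner_dw_dz_sub (u v : E) :
    ⟪fderiv ℝ w x u, fderiv ℝ z x v⟫_ℂ - ⟪fderiv ℝ w x v, fderiv ℝ z x u⟫_ℂ
      = ((‖w x‖ ^ 2 * dForm θ x u v + (fderiv ℝ (fun y => ‖w y‖ ^ 2) x u * θ x v
        - fderiv ℝ (fun y => ‖w y‖ ^ 2) x v * θ x u) : ℝ) : ℂ) := by
  have hρθ : innerForm w z =ᶠ[𝓝 x] fun y => toComplexForm (‖w y‖ ^ 2 • θ y) := by
    filter_upwards [H.eventually_mem hx] with y hy
    exact ContinuousLinearMap.ext fun v => H.inner_w_dz hy v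
  have hρ := H.differentiableAt hx (H.smooth_w.norm_sq ℂ)
  have hθ := H.differentiableAt hx H.smooth_θ
  rw [← dForm_innerForm (H.differentiableAt hx H.smooth_w) (H.contDiffAt hx H.smooth_z),
    dForm_congr hρθ, dForm_toComplexForm (hρ.fun_smul hθ), dForm_smul hρ hθ]
  simp only [smul_eq_mul]

theorem inner_dwξ_dz {v : E} (hv : θ x v = 0) :
    ⟪fderiv ℝ w x (ξ x), fderiv ℝ z x v⟫_ℂ = -⟪w x, fderiv ℝ w x v⟫_ℂ := by
  have h := H.inner_dw_dz_sub hx v (ξ x)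
  rw [hv, H.θ_ξ x hx, H.z_ξ x hx, H.dθ_ξ hx, mul_zero, mul_zero, zero_add, sub_zero, mul_one,
    ofReal_fderiv_norm_sq (H.differentiableAt hx H.smooth_w)] at h
  linear_combination -h

theorem inner_w_dbar {v : E} (hv : θ x v = 0) : ⟪w x, dbar J w x v⟫_ℂ = 0 := by
  have h := H.inner_dwξ_dz hx hv
  have hJ := H.inner_dwξ_dz hx (H.θ_J x hx v hv)
  rw [H.z_J x hx v hv, inner_smul_right] at hJ
  rw [dbar, inner_add_right, inner_smul_right]
  linear_combination h + Complex.I * hJ - ⟪fderiv ℝ w x (ξ x), fderiv ℝ z x v⟫_ℂ * Complex.I_sq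

theorem inner_dw {v : E} (hv : θ x v = 0) {h : W} (hh : ⟪w x, h⟫_ℂ = 0) :
    ⟪h, fderiv ℝ w x v⟫_ℂ = Complex.I * (‖w x‖ ^ 2 : ℝ) * ⟪h, fderiv ℝ z x v⟫_ℂ
      + 1 / 2 * ⟪h, dbar J w x v⟫_ℂ := by
  obtain ⟨u, hu, rfl⟩ := H.surj hx hh
  have huv := congrArg conj (H.inner_dw_dz_sub hx v u)
  have huJ := congrArg conj (H.inner_dw_dz_sub hx (J x v) u)
  simp only [hv, hu, H.θ_J x hx v hv, H.z_J x hx v hv, mul_zero, sub_zero, add_zero,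
    Complex.ofReal_mul, H.ofReal_dθ hx, map_sub, map_mul, map_neg, inner_conj_symm,
    Complex.conj_ofReal, Complex.conj_I, inner_smul_right, inner_smul_left] at huv huJ
  rw [dbar, inner_add_right, inner_smul_right]
  linear_combination huv / 2 - Complex.I / 2 * huJ + Complex.I_sq * (
    ⟪fderiv ℝ z x v, fderiv ℝ w x u⟫_ℂ / 2
    - (‖w x‖ ^ 2 : ℝ) * Complex.I / 2
      * (⟪fderiv ℝ z x u, fderiv ℝ z x v⟫_ℂ + ⟪fderiv ℝ z x v, fderiv ℝ z x u⟫_ℂ))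

end SecondOrder

end IsContactHypersurface

namespace IsContactHypersurface

variable {E : Type*} [NormedAddCommGroup E] [NormedSpace ℝ E] [FiniteDimensional ℝ E]
  {F : Type*} [NormedAddCommGroup F] [NormedSpace ℝ F]
  {W : Type*} [NormedAddCommGroup W] [InnerProductSpace ℂ W] [NormedSpace ℝ W]
  [IsScalarTower ℝ ℂ W]
  {V : Set E} {θ : E → E →L[ℝ] ℝ} {J : E → E →L[ℝ] E} {z w : E → W} {ξ : E → E}
  (H : IsContactHypersurface V θ J z w ξ) {x : E} (hx : x ∈ V) {v : E}

include H hx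

theorem fderiv_eq_zero {φ : E → F} (hφ : ContDiffOn ℝ ∞ φ V)
    (h : ∀ y ∈ V, ∀ u, θ y u = 0 → fderiv ℝ φ y u = 0) (hv : θ x v = 0) (hv0 : v ≠ 0) :
    fderiv ℝ φ x = 0 := by
  have hφθ : ∀ y ∈ V, fderiv ℝ φ y = (θ y).smulRight (fderiv ℝ φ y (ξ y)) := fun y hy =>
    ContinuousLinearMap.ext fun u => by
      have := h y hy _ (H.θ_sub_smul_ξ hy u)
      rwa [map_sub, map_smul, sub_eq_zero] at this
  have hκ := (contDiffOn_fderiv H.isOpen hφ).clm_apply H.smooth_ξ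
  have hdθ : dForm θ x v (J x v) ≠ 0 := by
    rw [H.dθ_J hx hv]
    simpa using mt (H.inj x hx v) hv0
  rw [hφθ x hx, eq_zero_of_fderiv_eq_smulRight (H.contDiffAt hx hφ)
    (H.differentiableAt hx H.smooth_θ) (H.differentiableAt hx hκ)
    ((H.eventually_mem hx).mono hφθ) hv (H.θ_J x hx v hv) hdθ, ContinuousLinearMap.smulRight_zero]

variable (hD : ∀ y ∈ V, ∀ u, θ y u = 0 → dbar J w y u = 0)

include hD

omit [FiniteDimensional ℝ E] [IsScalarTower ℝ ℂ W] H in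
theorem dw_J (hv : θ x v = 0) : fderiv ℝ w x (J x v) = Complex.I • fderiv ℝ w x v := by
  have h := congrArg (Complex.I • ·) (hD x hx v hv)
  simp only [dbar, smul_add, smul_smul, Complex.I_mul_I, neg_one_smul, smul_zero] at h
  exact (add_neg_eq_zero.1 h).symm

theorem dw_eq (hv : θ x v = 0) :
    fderiv ℝ w x v = (‖w x‖ ^ 2) • Complex.I • fderiv ℝ z x v
      + ((‖w x‖ ^ 2)⁻¹ • ⟪w x, fderiv ℝ w x v⟫_ℂ) • w x := by
  set a := fderiv ℝ w x v - (‖w x‖ ^ 2) • Complex.I • fderiv ℝ z x v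
    - ((‖w x‖ ^ 2)⁻¹ • ⟪w x, fderiv ℝ w x v⟫_ℂ) • w x with ha
  have hwa : ⟪w x, a⟫_ℂ = 0 := by
    rw [ha, inner_sub_right, inner_sub_right, inner_smul_right_eq_smul, inner_smul_right,
      inner_smul_right, H.orth x hx v hv, inner_self_eq_ofReal,
      Complex.real_smul, Complex.real_smul, Complex.ofReal_inv, mul_right_comm,
      inv_mul_cancel₀ (H.norm_sq_ne hx)]
    ring
  have haa : ⟪a, a⟫_ℂ = 0 := by
    nth_rewrite 2 [ha]
    rw [inner_sub_right, inner_sub_right, H.inner_dw hx hv hwa, hD x hx v hv,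
      inner_smul_right_eq_smul, Complex.real_smul, inner_smul_right, inner_smul_right,
      inner_eq_zero_symm.1 hwa, inner_zero_right]
    ring
  rw [← sub_eq_zero, ← sub_sub, ← ha, inner_self_eq_zero.1 haa]

omit hx in
theorem exists_dw_eq : ∃ (b : E → E →L[ℝ] ℂ) (σ : E → W), ContDiffOn ℝ ∞ b V ∧ ContDiffOn ℝ ∞ σ V ∧
    (∀ y u, b y u = (‖w y‖ ^ 2)⁻¹ • ⟪w y, fderiv ℝ w y u⟫_ℂ) ∧ ∀ y ∈ V, ∀ u,
      fderiv ℝ w y u = (‖w y‖ ^ 2) • Complex.I • fderiv ℝ z y u + b y u • w y + θ y u • σ y := by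
  have hw := H.smooth_w
  have hdwξ := (contDiffOn_fderiv H.isOpen hw).clm_apply H.smooth_ξ
  have hρ : ContDiffOn ℝ ∞ (fun y => ‖w y‖ ^ 2) V := hw.norm_sq ℂ
  have hb : ContDiffOn ℝ ∞ (fun y => (‖w y‖ ^ 2)⁻¹ • innerForm w w y) V :=
    (hρ.inv fun y hy => pow_ne_zero 2 (norm_ne_zero_iff.2 (H.w_ne hy))).smul
      (contDiffOn_innerForm H.isOpen hw hw)
  refine ⟨_, fun y => fderiv ℝ w y (ξ y) - (‖w y‖ ^ 2) • Complex.I • w y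
    - ((‖w y‖ ^ 2)⁻¹ • ⟪w y, fderiv ℝ w y (ξ y)⟫_ℂ) • w y, hb,
    (hdwξ.sub (hρ.smul (contDiffOn_const.smul hw))).sub ((hb.clm_apply H.smooth_ξ).smul hw),
    fun _ _ => rfl, fun y hy u => ?_⟩
  have h := H.dw_eq hy hD (H.θ_sub_smul_ξ hy u)
  rw [H.dz_sub_smul_ξ hy, map_sub, map_smul, inner_sub_right, inner_smul_right_eq_smul,
    sub_eq_iff_eq_add] at h
  refine h.trans ?_
  simp only [innerForm_apply, smul_apply, smul_sub, sub_smul, smul_assoc,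
    smul_comm _ (θ y u)]
  abel

/- The exterior derivative of `exists_dw_eq`, paired with the fixed vector `h`. -/
theorem codazzi {h : W} (hh : ⟪h, w x⟫_ℂ = 0) {u : E} (hu : θ x u = 0) (hv : θ x v = 0) :
    fderiv ℝ (fun y => ‖w y‖ ^ 2) x u • (Complex.I * ⟪h, fderiv ℝ z x v⟫_ℂ)
      - fderiv ℝ (fun y => ‖w y‖ ^ 2) x v • (Complex.I * ⟪h, fderiv ℝ z x u⟫_ℂ)
      + (‖w x‖ ^ 2)⁻¹ • (⟪h, fderiv ℝ w x u⟫_ℂ * ⟪w x, fderiv ℝ w x v⟫_ℂ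
        - ⟪h, fderiv ℝ w x v⟫_ℂ * ⟪w x, fderiv ℝ w x u⟫_ℂ)
      + dForm θ x u v • ⟪h, fderiv ℝ w x (ξ x)⟫_ℂ = 0 := by
  obtain ⟨b, σ, hb, hσ, hb_apply, hdw⟩ := H.exists_dw_eq hD
  have hbx := H.differentiableAt hx hb
  have hwx := H.differentiableAt hx H.smooth_w
  have hρx : DifferentiableAt ℝ (fun y => ‖w y‖ ^ 2) x := hwx.norm_sq ℂ
  have hθx := H.differentiableAt hx H.smooth_θ
  have hform : innerForm (fun _ => h) w =ᶠ[𝓝 x] fun y => ((‖w y‖ ^ 2) •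
      innerForm (fun _ => -(Complex.I • h)) z y + ⟪h, w y⟫_ℂ • b y)
        + ⟪h, σ y⟫_ℂ • toComplexForm (θ y) := by
    filter_upwards [H.eventually_mem hx] with y hy
    ext u
    simp [hdw y hy u, inner_smul_right, inner_smul_left, inner_neg_left,
      inner_smul_right_eq_smul, toComplexForm, mul_comm]
  have hgz := H.differentiableAt hx
    (contDiffOn_innerForm H.isOpen (contDiffOn_const (c := -(Complex.I • h))) H.smooth_z)
  have hhw : DifferentiableAt ℝ (fun y => ⟪h, w y⟫_ℂ) x := (differentiableAt_const h).inner ℂ hwx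
  have hhσ : DifferentiableAt ℝ (fun y => ⟪h, σ y⟫_ℂ) x :=
    (differentiableAt_const h).inner ℂ (H.differentiableAt hx hσ)
  have hθx' : DifferentiableAt ℝ (fun y => toComplexForm (θ y)) x :=
    (differentiableAt_const _).clm_comp hθx
  have hhσx : ⟪h, σ x⟫_ℂ = ⟪h, fderiv ℝ w x (ξ x)⟫_ℂ := by
    simp [hdw x hx (ξ x), H.z_ξ x hx, H.θ_ξ x hx, inner_smul_right, inner_smul_right_eq_smul, hh]
  have hd := dForm_congr hform u v
  rw [dForm_add ((hρx.fun_smul hgz).fun_add (hhw.fun_smul hbx)) (hhσ.fun_smul hθx'),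
    dForm_add (hρx.fun_smul hgz) (hhw.fun_smul hbx), dForm_smul hρx hgz, dForm_smul hhw hbx,
    dForm_smul hhσ hθx', dForm_toComplexForm hθx,
    dForm_innerForm (differentiableAt_const _) (H.contDiffAt hx H.smooth_w),
    dForm_innerForm (differentiableAt_const _) (H.contDiffAt hx H.smooth_z)] at hd
  simp only [fderiv_inner_apply ℂ (differentiableAt_const h) hwx, hhσx, hh, hb_apply, hu, hv,
    innerForm_apply, fderiv_fun_const, Pi.zero_apply, zero_apply, inner_zero_left, inner_neg_left,
    inner_smul_left, Complex.conj_I, toComplexForm, ContinuousLinearMap.comp_apply] at hd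
  simp only [sub_self, smul_zero, neg_mul, neg_neg, Complex.real_smul, zero_add, smul_eq_mul,
    zero_mul, add_zero, Complex.ofReal_inv, Complex.ofReal_pow, Complex.ofRealCLM_apply,
    Complex.ofReal_zero, mul_zero] at hd ⊢
  linear_combination -hd

theorem inner_w_dw (hv : θ x v = 0) : ⟪w x, fderiv ℝ w x v⟫_ℂ = 0 := by
  by_cases hv0 : v = 0
  · rw [hv0, map_zero, inner_zero_right]
  have hh := inner_eq_zero_symm.1 (H.orth x hx v hv)
  have hcod := H.codazzi hx hD hh hv (H.θ_J x hx v hv)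
  have hξ := congrArg conj (H.inner_dwξ_dz hx hv)
  rw [map_neg, inner_conj_symm, inner_conj_symm] at hξ
  rw [hξ, H.dθ_J hx hv, H.z_J x hx v hv, dw_J hx hD hv] at hcod
  simp only [inner_smul_right, mul_left_comm _ Complex.I, mul_assoc, sub_self, smul_zero,
    Complex.real_smul, inner_self_eq_ofReal,
    ofReal_fderiv_norm_sq (H.differentiableAt hx H.smooth_w),
    dw_J hx hD hv, inner_smul_left, Complex.conj_I] at hcod
  have h0 : ((‖fderiv ℝ z x v‖ ^ 2 : ℝ) : ℂ) * ⟪fderiv ℝ w x v, w x⟫_ℂ = 0 := by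
    push_cast at hcod ⊢
    linear_combination -hcod / 4
      + (‖fderiv ℝ z x v‖ ^ 2 * ⟪fderiv ℝ w x v, w x⟫_ℂ / 2) * Complex.I_sq
  refine inner_eq_zero_symm.1 ((mul_eq_zero.1 h0).resolve_left ?_)
  simpa using mt (H.inj x hx v) hv0

theorem fderiv_norm_sq_eq_zero (hv : θ x v = 0) (hv0 : v ≠ 0) :
    fderiv ℝ (fun y => ‖w y‖ ^ 2) x = 0 := by
  refine H.fderiv_eq_zero hx (H.smooth_w.norm_sq ℂ) (fun y hy u hu => ?_) hv hv0
  have h := ofReal_fderiv_norm_sq (H.differentiableAt hy H.smooth_w) u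
  rw [H.inner_w_dw hy hD hu, inner_eq_zero_symm.1 (H.inner_w_dw hy hD hu), add_zero] at h
  exact_mod_cast h

theorem fderiv_sub_eq_zero (hne : ∀ y ∈ V, ∃ v, θ y v = 0 ∧ v ≠ 0) :
    fderiv ℝ (fun y => w y - (‖w y‖ ^ 2) • Complex.I • z y) x = 0 := by
  have hIz : ContDiffOn ℝ ∞ (fun y => Complex.I • z y) V := contDiffOn_const.smul H.smooth_z
  have hρ := H.smooth_w.norm_sq ℂ
  obtain ⟨v, hv, hv0⟩ := hne x hx
  refine H.fderiv_eq_zero hx (H.smooth_w.sub (hρ.smul hIz)) (fun y hy u hu => ?_) hv hv0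
  obtain ⟨v', hv', hv0'⟩ := hne y hy
  have hdw := H.dw_eq hy hD hu
  rw [H.inner_w_dw hy hD hu, smul_zero, zero_smul, add_zero] at hdw
  have hdρ := H.differentiableAt hy hρ
  have hdIz := H.differentiableAt hy hIz
  rw [fderiv_fun_sub (H.differentiableAt hy H.smooth_w) (hdρ.fun_smul hdIz),
    fderiv_fun_smul hdρ hdIz,
    H.fderiv_norm_sq_eq_zero hy hD hv' hv0',
    fderiv_fun_const_smul (H.differentiableAt hy H.smooth_z)]
  simp [hdw]

end IsContactHypersurface

section UnitaryBases

variable {W : Type*} [NormedAddCommGroup W] [InnerProductSpace ℂ W] {m : ℕ} {w : W} {g : Fin m → W}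
  (hdim : Module.finrank ℂ W = m + 1) (hw : w ≠ 0) (hg : Orthonormal ℂ g)
  (hwg : ∀ k, ⟪w, g k⟫_ℂ = 0)

include hdim hw hg hwg

theorem eq_sum_of_orthonormal (h : W) :
    h = (⟪w, h⟫_ℂ / ((‖w‖ ^ 2 : ℝ) : ℂ)) • w + ∑ k, ⟪g k, h⟫_ℂ • g k := by
  have hw' : (‖w‖ : ℂ) ≠ 0 := by simpa using hw
  have ho : Orthonormal ℂ (Matrix.vecCons ((‖w‖ : ℂ)⁻¹ • w) g) := by
    refine orthonormal_vecCons_iff.2 ⟨?_, fun k => ?_, hg⟩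
    · rw [norm_smul, norm_inv, Complex.norm_real, norm_norm, inv_mul_cancel₀ (by simpa using hw)]
    · rw [inner_smul_left, hwg, mul_zero]
  have : FiniteDimensional ℂ W := Module.finite_of_finrank_pos (by omega)
  let B := (basisOfOrthonormalOfCardEqFinrank ho (by simp [hdim])).toOrthonormalBasis
    (by simpa using ho)
  have hB : ∀ i, B i = Matrix.vecCons ((‖w‖ : ℂ)⁻¹ • w) g i := fun i => by simp [B]
  have hsum := B.sum_repr' h
  simp only [hB, Fin.sum_univ_succ, Matrix.cons_val_zero, Matrix.cons_val_succ, inner_smul_left,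
    smul_smul, map_inv₀, Complex.conj_ofReal] at hsum
  conv_lhs => rw [← hsum]
  congr 2
  push_cast
  field_simp

theorem inner_eq_sum_of_orthonormal (a b : W) :
    ⟪a, b⟫_ℂ = ⟪a, w⟫_ℂ * ⟪w, b⟫_ℂ / ((‖w‖ ^ 2 : ℝ) : ℂ) + ∑ k, ⟪a, g k⟫_ℂ * ⟪g k, b⟫_ℂ := by
  conv_lhs => rw [eq_sum_of_orthonormal hdim hw hg hwg b]
  simp only [inner_add_right, inner_smul_right, inner_sum]
  congr 1
  · ring
  · exact Finset.sum_congr rfl fun k _ => mul_comm _ _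

end UnitaryBases

theorem finrank_PHModel (m : ℕ) :
    Module.finrank ℝ (PHModel m) = Module.finrank ℝ (ℝ × (Fin m → ℂ)) := by
  simp only [finrank_euclideanSpace, Fintype.card_fin, Module.finrank_prod, Module.finrank_self,
    Module.finrank_pi_fintype, Complex.finrank_real_complex, Finset.sum_const, Finset.card_univ,
    smul_eq_mul]
  ring

namespace IsAdmissibleCoframe

variable {m : ℕ} {V : Set (PHModel m)} {θ : PHModel m → PHModel m →L[ℝ] ℝ}
  {J : PHModel m → PHModel m →L[ℝ] PHModel m} {ϑ : Fin m → PHModel m → PHModel m →L[ℝ] ℂ}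
  (hϑ : IsAdmissibleCoframe V θ J ϑ)

include hϑ

theorem eq_zero_of_prod_apply_eq_zero {x : PHModel m} (hx : x ∈ V) {v : PHModel m}
    (hv : (θ x).prod (ContinuousLinearMap.pi fun k => ϑ k x) v = 0) : v = 0 :=
  hϑ.coframe x hx v (congrArg Prod.fst hv) fun j => congrFun (congrArg Prod.snd hv) j

theorem exists_contDiffOn_eq (hθ : ContDiffOn ℝ ∞ θ V) (s : ℝ) (c : Fin m → ℂ) :
    ∃ X : PHModel m → PHModel m, ContDiffOn ℝ ∞ X V ∧
      ∀ x ∈ V, θ x (X x) = s ∧ ∀ j, ϑ j x (X x) = c j := by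
  have hA : ContDiffOn ℝ ∞ (fun x => (θ x).prod (ContinuousLinearMap.pi fun k => ϑ k x)) V :=
    contDiffOn_clm_apply.2 fun v => (hθ.clm_apply contDiffOn_const).prodMk
      (contDiffOn_pi.2 fun k => (hϑ.smooth k).clm_apply contDiffOn_const)
  obtain ⟨X, hX, hAX⟩ := exists_contDiffOn_apply_eq hA
    (contDiffOn_const (c := ((s, c) : ℝ × (Fin m → ℂ)))) (finrank_PHModel m)
    fun x hx v hv => hϑ.eq_zero_of_prod_apply_eq_zero hx hv
  exact ⟨X, hX, fun x hx => ⟨congrArg Prod.fst (hAX x hx),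
    fun j => congrFun (congrArg Prod.snd (hAX x hx)) j⟩⟩

theorem exists_eq {x : PHModel m} (hx : x ∈ V) (s : ℝ) (c : Fin m → ℂ) :
    ∃ v, θ x v = s ∧ ∀ j, ϑ j x v = c j := by
  obtain ⟨v, hv⟩ := (isInvertible_of_apply_eq_zero (finrank_PHModel m)
    fun _ hv => hϑ.eq_zero_of_prod_apply_eq_zero hx hv).bijective.2 (s, c)
  exact ⟨v, congrArg Prod.fst hv, fun j => congrFun (congrArg Prod.snd hv) j⟩

theorem eq_sum_of_dual {x : PHModel m} (hx : x ∈ V) (hJ : ∀ v, θ x v = 0 → θ x (J x v) = 0)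
    {X : Fin m → PHModel m} (hθX : ∀ k, θ x (X k) = 0)
    (hϑX : ∀ j k, ϑ j x (X k) = if j = k then 1 else 0) {v : PHModel m} (hv : θ x v = 0) :
    v = ∑ k, ((ϑ k x v).re • X k + (ϑ k x v).im • J x (X k)) := by
  rw [← sub_eq_zero]
  refine hϑ.coframe x hx _ ?_ fun j => ?_
  · simp [hv, hθX, hJ]
  · simp [hϑ.type_one_zero x hx _ _ (hθX _), hϑX, Finset.sum_add_distrib]

end IsAdmissibleCoframe

/-- A smooth frame `X` of the contact distribution, `g = dz X`, which is unitary for the pullback by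
`z` of the Hermitian metric. -/
structure IsUnitaryFrame {m : ℕ} {W : Type*} [NormedAddCommGroup W] [InnerProductSpace ℂ W]
    [NormedSpace ℝ W] (V : Set (PHModel m)) (θ : PHModel m → PHModel m →L[ℝ] ℝ)
    (z : PHModel m → W) (X : Fin m → PHModel m → PHModel m) (g : Fin m → PHModel m → W) :
    Prop where
  smooth_X : ∀ k, ContDiffOn ℝ ∞ (X k) V
  smooth_g : ∀ k, ContDiffOn ℝ ∞ (g k) V
  θ_X : ∀ x ∈ V, ∀ k, θ x (X k x) = 0
  z_X : ∀ x ∈ V, ∀ k, fderiv ℝ z x (X k x) = g k x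
  orthonormal : ∀ x ∈ V, Orthonormal ℂ fun k => g k x

namespace IsContactHypersurface

section Coframes

variable {m : ℕ} {W : Type*} [NormedAddCommGroup W] [InnerProductSpace ℂ W] [NormedSpace ℝ W]
  {V : Set (PHModel m)} {θ : PHModel m → PHModel m →L[ℝ] ℝ}
  {J : PHModel m → PHModel m →L[ℝ] PHModel m} {z w : PHModel m → W} {ξ : PHModel m → PHModel m}
  (H : IsContactHypersurface V θ J z w ξ) {x : PHModel m} (hx : x ∈ V)
  {ϑ : Fin m → PHModel m → PHModel m →L[ℝ] ℂ} {X : Fin m → PHModel m → PHModel m}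
  {g : Fin m → PHModel m → W}

include H

include hx in
theorem inner_dz_eq_sum_coframe (hϑ : IsAdmissibleCoframe V θ J ϑ) (v : PHModel m) {u : PHModel m}
    (hu : θ x u = 0) :
    ⟪fderiv ℝ z x v, fderiv ℝ z x u⟫_ℂ = ∑ k, conj (ϑ k x v) * ϑ k x u := by
  have hlevi : ∀ u, ⟪fderiv ℝ z x v, fderiv ℝ z x u⟫_ℂ - ⟪fderiv ℝ z x u, fderiv ℝ z x v⟫_ℂ
      = ∑ k, conj (ϑ k x v) * ϑ k x u - ∑ k, ϑ k x v * conj (ϑ k x u) := fun u => by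
    have h := hϑ.levi x hx v u
    simp only [H.ofReal_dθ hx, wedge, conjForm, ContinuousLinearMap.comp_apply,
      ContinuousLinearEquiv.coe_coe, Complex.conjCLE_apply, Finset.sum_sub_distrib] at h
    simp only [mul_comm (conj (ϑ _ x v))]
    refine mul_left_cancel₀ Complex.I_ne_zero ?_
    linear_combination -h
  have h := hlevi u
  have hJ := hlevi (J x u)
  simp only [H.z_J x hx u hu, inner_smul_right, inner_smul_left, hϑ.type_one_zero x hx _ u hu,
    map_mul, Complex.conj_I] at hJ
  simp only [mul_left_comm _ Complex.I, mul_left_comm _ (-Complex.I),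
    ← Finset.mul_sum] at hJ
  refine mul_left_cancel₀ (two_ne_zero' ℂ) ?_
  linear_combination h - Complex.I * hJ
    + (⟪fderiv ℝ z x v, fderiv ℝ z x u⟫_ℂ + ⟪fderiv ℝ z x u, fderiv ℝ z x v⟫_ℂ
      - ∑ k, conj (ϑ k x v) * ϑ k x u - ∑ k, ϑ k x v * conj (ϑ k x u)) * Complex.I_sq

theorem exists_unitaryFrame (hϑ : IsAdmissibleCoframe V θ J ϑ) :
    ∃ X g, IsUnitaryFrame V θ z X g ∧ ∀ x ∈ V, ∀ k v, ϑ k x v = ⟪g k x, fderiv ℝ z x v⟫_ℂ := by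
  choose X hX hX_apply using fun k => hϑ.exists_contDiffOn_eq H.smooth_θ 0 (Pi.single k 1)
  have hϑ_apply : ∀ x ∈ V, ∀ k v, ϑ k x v = ⟪fderiv ℝ z x (X k x), fderiv ℝ z x v⟫_ℂ := by
    intro x hx k v
    rw [← inner_conj_symm, H.inner_dz_eq_sum_coframe hx hϑ v (hX_apply k x hx).1]
    simp [(hX_apply k x hx).2, Pi.single_apply]
  refine ⟨X, fun k x => fderiv ℝ z x (X k x), ⟨hX, fun k => ?_, fun x hx k => (hX_apply k x hx).1,
    fun _ _ _ => rfl, fun x hx => orthonormal_iff_ite.2 fun j k => ?_⟩, hϑ_apply⟩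
  · exact (contDiffOn_fderiv H.isOpen H.smooth_z).clm_apply (hX k)
  · rw [← hϑ_apply x hx, (hX_apply k x hx).2, Pi.single_apply]

theorem inner_w_g (hX : IsUnitaryFrame V θ z X g) (hx : x ∈ V) (k : Fin m) :
    ⟪w x, g k x⟫_ℂ = 0 := by
  rw [← hX.z_X x hx, H.orth x hx _ (hX.θ_X x hx k)]

variable [IsScalarTower ℝ ℂ W]

theorem finrank_complex : Module.finrank ℂ W = m + 1 := by
  have h := H.codim_one
  rw [finrank_euclideanSpace_fin, ← Module.finrank_mul_finrank ℝ ℂ W,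
    Complex.finrank_real_complex] at h
  omega

include hx in
theorem inner_dz_eq_sum (hg : Orthonormal ℂ fun k => g k x) (hwg : ∀ k, ⟪w x, g k x⟫_ℂ = 0)
    (v u : PHModel m) : ⟪fderiv ℝ z x v, fderiv ℝ z x u⟫_ℂ
    = ((‖w x‖ ^ 2 * θ x v * θ x u : ℝ) : ℂ)
      + ∑ k, ⟪fderiv ℝ z x v, g k x⟫_ℂ * ⟪g k x, fderiv ℝ z x u⟫_ℂ := by
  rw [inner_eq_sum_of_orthonormal H.finrank_complex (H.w_ne hx) hg hwg,
    ← inner_conj_symm (fderiv ℝ z x v) (w x), H.inner_w_dz hx, H.inner_w_dz hx,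
    Complex.conj_ofReal]
  have hρ := H.norm_sq_ne hx
  congr 1
  push_cast at hρ ⊢
  field_simp

theorem isAdmissibleCoframe_innerForm (hg_smooth : ∀ k, ContDiffOn ℝ ∞ (g k) V)
    (hg : ∀ x ∈ V, Orthonormal ℂ fun k => g k x) (hwg : ∀ x ∈ V, ∀ k, ⟪w x, g k x⟫_ℂ = 0) :
    IsAdmissibleCoframe V θ J fun k => innerForm (g k) z where
  smooth j := contDiffOn_innerForm H.isOpen (hg_smooth j) H.smooth_z
  type_one_zero x hx j v hv := by
    rw [innerForm_apply, innerForm_apply, H.z_J x hx v hv, inner_smul_right]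
  coframe x hx v hv h := by
    simp only [innerForm_apply] at h
    refine H.inj x hx v ?_
    rw [eq_sum_of_orthonormal H.finrank_complex (H.w_ne hx) (hg x hx) (hwg x hx)
      (fderiv ℝ z x v), H.orth x hx v hv]
    simp [h]
  levi x hx v u := by
    rw [H.ofReal_dθ hx, H.inner_dz_eq_sum hx (hg x hx) (hwg x hx),
      H.inner_dz_eq_sum hx (hg x hx) (hwg x hx)]
    simp only [wedge, conjForm, ContinuousLinearMap.comp_apply, innerForm_apply,
      ContinuousLinearEquiv.coe_coe, Complex.conjCLE_apply, inner_conj_symm,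
      Finset.sum_sub_distrib, mul_comm ⟪fderiv ℝ z x _, g _ x⟫_ℂ]
    push_cast
    ring

end Coframes

end IsContactHypersurface

namespace IsContactHypersurface

section TorsionOperator

variable {E : Type*} [NormedAddCommGroup E] [NormedSpace ℝ E]
  {W : Type*} [NormedAddCommGroup W] [InnerProductSpace ℂ W] [NormedSpace ℝ W]
  {V : Set E} {θ : E → E →L[ℝ] ℝ} {J : E → E →L[ℝ] E} {z w : E → W} {ξ : E → E}
  (H : IsContactHypersurface V θ J z w ξ) {x : E} (hx : x ∈ V) {v : E} (hv : θ x v = 0)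

include H hx hv

theorem J_J : J x (J x v) = -v := by
  refine add_eq_zero_iff_eq_neg.1 (H.inj x hx _ ?_)
  rw [map_add, H.z_J x hx _ (H.θ_J x hx v hv), H.z_J x hx v hv, smul_smul, Complex.I_mul_I,
    neg_one_smul, neg_add_cancel]

theorem dbar_J : dbar J w x (J x v) = -(Complex.I • dbar J w x v) := by
  simp only [dbar, H.J_J hx hv, map_neg, smul_neg, smul_add, smul_smul, Complex.I_mul_I,
    neg_one_smul, neg_add_rev, neg_neg]

end TorsionOperator

section Frames

variable {m : ℕ} {W : Type*} [NormedAddCommGroup W] [InnerProductSpace ℂ W] [NormedSpace ℝ W]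
  [IsScalarTower ℝ ℂ W]
  {V : Set (PHModel m)} {θ : PHModel m → PHModel m →L[ℝ] ℝ}
  {J : PHModel m → PHModel m →L[ℝ] PHModel m} {z w : PHModel m → W} {ξ : PHModel m → PHModel m}
  (H : IsContactHypersurface V θ J z w ξ) {x : PHModel m} (hx : x ∈ V)
  {X : Fin m → PHModel m → PHModel m} {g : Fin m → PHModel m → W} (hX : IsUnitaryFrame V θ z X g)

include H hX hx

theorem dbar_eq_sum {v : PHModel m} (hv : θ x v = 0) :
    dbar J w x v = ∑ k, ⟪fderiv ℝ z x v, g k x⟫_ℂ • dbar J w x (X k x) := by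
  have hϑ := H.isAdmissibleCoframe_innerForm hX.smooth_g hX.orthonormal
    fun y hy k => H.inner_w_g hX hy k
  have hsum : ∀ a b : Fin m → ℝ, dbar J w x (∑ k, (a k • X k x + b k • J x (X k x)))
      = ∑ k, (a k • dbar J w x (X k x) + b k • dbar J w x (J x (X k x))) := fun a b => by
    simp only [dbar, map_sum, map_add, map_smul, smul_add, Finset.smul_sum,
      Finset.sum_add_distrib, smul_comm Complex.I]
    abel
  conv_lhs => rw [hϑ.eq_sum_of_dual hx (H.θ_J x hx) (X := fun k => X k x) (hX.θ_X x hx)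
    (fun j k => by rw [innerForm_apply, hX.z_X x hx, orthonormal_iff_ite.1 (hX.orthonormal x hx)])
    hv, hsum]
  refine Finset.sum_congr rfl fun k _ => ?_
  rw [innerForm_apply, ← inner_conj_symm (fderiv ℝ z x v), H.dbar_J hx (hX.θ_X x hx k)]
  generalize ⟪g k x, fderiv ℝ z x v⟫_ℂ = c
  rw [smul_neg, ← smul_assoc, ← neg_smul, ← smul_one_smul ℂ c.re, ← add_smul]
  congr 1
  apply Complex.ext <;> simp

theorem inner_fderiv_frame_w (j : Fin m) (b : PHModel m) :
    ⟪fderiv ℝ (g j) x b, w x⟫_ℂ = -⟪g j x, fderiv ℝ w x b⟫_ℂ :=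
  inner_fderiv_of_const (H.differentiableAt hx (hX.smooth_g j)) (H.differentiableAt hx H.smooth_w)
    ((H.eventually_mem hx).mono fun _ hy => inner_eq_zero_symm.1 (H.inner_w_g hX hy j)) b

omit [IsScalarTower ℝ ℂ W] in
theorem inner_fderiv_frame (j k : Fin m) (b : PHModel m) :
    ⟪fderiv ℝ (g j) x b, g k x⟫_ℂ = -⟪g j x, fderiv ℝ (g k) x b⟫_ℂ :=
  inner_fderiv_of_const (H.differentiableAt hx (hX.smooth_g j))
    (H.differentiableAt hx (hX.smooth_g k))
    ((H.eventually_mem hx).mono fun y hy => orthonormal_iff_ite.1 (hX.orthonormal y hy) j k) b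

theorem sum_inner_mul_inner_fderiv_frame (j : Fin m) (b : PHModel m) (h : W) :
    ∑ k, ⟪g k x, h⟫_ℂ * ⟪g j x, fderiv ℝ (g k) x b⟫_ℂ = -⟪fderiv ℝ (g j) x b, h⟫_ℂ
      - ⟪g j x, fderiv ℝ w x b⟫_ℂ * ⟪w x, h⟫_ℂ / ((‖w x‖ ^ 2 : ℝ) : ℂ) := by
  rw [inner_eq_sum_of_orthonormal H.finrank_complex (H.w_ne hx) (hX.orthonormal x hx)
    (H.inner_w_g hX hx) (fderiv ℝ (g j) x b) h, H.inner_fderiv_frame_w hx hX]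
  simp only [H.inner_fderiv_frame hx hX j, neg_mul, Finset.sum_neg_distrib,
    mul_comm ⟪g _ x, h⟫_ℂ]
  ring

end Frames

end IsContactHypersurface

section Connection

variable {m : ℕ} {W : Type*} [NormedAddCommGroup W] [InnerProductSpace ℂ W] [NormedSpace ℝ W]
  [IsScalarTower ℝ ℂ W]
  {V : Set (PHModel m)} {θ : PHModel m → PHModel m →L[ℝ] ℝ}
  {J : PHModel m → PHModel m →L[ℝ] PHModel m} {z w : PHModel m → W} {ξ : PHModel m → PHModel m}
  {X : Fin m → PHModel m → PHModel m} {g : Fin m → PHModel m → W}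
  {ϑ : Fin m → PHModel m → PHModel m →L[ℝ] ℂ}

/-- The Tanaka–Webster connection forms `φ k j` of the coframe dual to the unitary frame `g`: the
forms `⟪g j, dg k⟫` of the flat connection, corrected by `-i ‖w‖² θ` on the diagonal. -/
def frameConnection (θ : PHModel m → PHModel m →L[ℝ] ℝ) (w : PHModel m → W)
    (g : Fin m → PHModel m → W) (k j : Fin m) (x : PHModel m) : PHModel m →L[ℝ] ℂ :=
  innerForm (g j) (g k) x
    - (if j = k then Complex.I * ((‖w x‖ ^ 2 : ℝ) : ℂ) else 0) • toComplexForm (θ x)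

theorem frameConnection_apply (k j : Fin m) (x v : PHModel m) :
    frameConnection θ w g k j x v = ⟪g j x, fderiv ℝ (g k) x v⟫_ℂ
      - (if j = k then Complex.I * ((‖w x‖ ^ 2 : ℝ) : ℂ) else 0) * ((θ x v : ℝ) : ℂ) := rfl

namespace IsContactHypersurface

variable (H : IsContactHypersurface V θ J z w ξ) (hX : IsUnitaryFrame V θ z X g)

include H

omit [IsScalarTower ℝ ℂ W] in
theorem smooth_toComplexForm : ContDiffOn ℝ ∞ (fun x => toComplexForm (θ x)) V :=
  contDiffOn_const.clm_comp H.smooth_θ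

theorem smooth_ite_norm_sq (j k : Fin m) : ContDiffOn ℝ ∞
    (fun x => if j = k then Complex.I * ((‖w x‖ ^ 2 : ℝ) : ℂ) else 0) V := by
  split_ifs
  · exact contDiffOn_const.mul
      (Complex.ofRealCLM.contDiff.comp_contDiffOn (H.smooth_w.norm_sq ℂ))
  · exact contDiffOn_const

include hX

theorem smooth_frameConnection (k j : Fin m) :
    ContDiffOn ℝ ∞ (frameConnection θ w g k j) V :=
  (contDiffOn_innerForm H.isOpen (hX.smooth_g j) (hX.smooth_g k)).sub
    ((H.smooth_ite_norm_sq j k).smul H.smooth_toComplexForm)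

variable {x : PHModel m} (hx : x ∈ V)

include hx

theorem frameConnection_add_conjForm (k j : Fin m) :
    frameConnection θ w g k j x + conjForm (frameConnection θ w g j k x) = 0 := by
  ext v
  simp only [add_apply, conjForm, ContinuousLinearMap.comp_apply, zero_apply,
    ContinuousLinearEquiv.coe_coe, Complex.conjCLE_apply, frameConnection_apply, map_sub, map_mul,
    inner_conj_symm, Complex.conj_ofReal, H.inner_fderiv_frame hx hX, eq_comm (a := k)]
  split_ifs <;> simp

theorem sum_inner_dz_mul_frameConnection (j : Fin m) (a b : PHModel m) :
    ∑ k, ⟪g k x, fderiv ℝ z x a⟫_ℂ * frameConnection θ w g k j x b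
      = -⟪fderiv ℝ (g j) x b, fderiv ℝ z x a⟫_ℂ - (θ x a : ℂ) * ⟪g j x, fderiv ℝ w x b⟫_ℂ
        - Complex.I * ((‖w x‖ ^ 2 : ℝ) : ℂ) * (θ x b : ℂ) * ⟪g j x, fderiv ℝ z x a⟫_ℂ := by
  simp only [frameConnection_apply, mul_sub, Finset.sum_sub_distrib, ite_mul, mul_ite, zero_mul,
    mul_zero, Finset.sum_ite_eq, Finset.mem_univ, if_true,
    H.sum_inner_mul_inner_fderiv_frame hx hX, H.inner_w_dz hx]
  rw [Complex.ofReal_mul, mul_left_comm, mul_div_cancel_left₀ _ (H.norm_sq_ne hx)]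
  ring

theorem sum_inner_dbar_mul (j : Fin m) (a : PHModel m) :
    ∑ k, 1 / 2 * ⟪g j x, dbar J w x (X k x)⟫_ℂ * ⟪fderiv ℝ z x a, g k x⟫_ℂ
      = ⟪g j x, fderiv ℝ w x a⟫_ℂ - Complex.I * ((‖w x‖ ^ 2 : ℝ) : ℂ) * ⟪g j x, fderiv ℝ z x a⟫_ℂ
        - (θ x a : ℂ) * ⟪g j x, fderiv ℝ w x (ξ x)⟫_ℂ := by
  have ha := H.θ_sub_smul_ξ hx a
  have hdw := H.inner_dw hx ha (H.inner_w_g hX hx j)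
  have hgw := inner_eq_zero_symm.1 (H.inner_w_g hX hx j)
  rw [H.dbar_eq_sum hx hX ha, H.dz_sub_smul_ξ hx, map_sub, map_smul, inner_sum] at hdw
  simp only [inner_sub_left, inner_sub_right, inner_smul_right, inner_smul_right_eq_smul,
    inner_smul_left_eq_smul, H.inner_w_g hX hx, hgw, Complex.real_smul, mul_zero, sub_zero,
    Finset.mul_sum] at hdw
  rw [Finset.sum_congr rfl fun k _ => (by ring : 1 / 2 * ⟪g j x, dbar J w x (X k x)⟫_ℂ
    * ⟪fderiv ℝ z x a, g k x⟫_ℂ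
    = 1 / 2 * (⟪fderiv ℝ z x a, g k x⟫_ℂ * ⟪g j x, dbar J w x (X k x)⟫_ℂ))]
  linear_combination -hdw

omit hx in
theorem isConnection_frameConnection
    (hϑ : ∀ x ∈ V, ∀ k v, ϑ k x v = ⟪g k x, fderiv ℝ z x v⟫_ℂ) :
    IsConnection V θ ϑ (frameConnection θ w g)
      (fun j k x => 1 / 2 * ⟪g j x, dbar J w x (X k x)⟫_ℂ) where
  smooth_φ := H.smooth_frameConnection hX
  smooth_A j k := by
    have hdw := contDiffOn_fderiv H.isOpen H.smooth_w
    exact contDiffOn_const.mul ((hX.smooth_g j).inner ℂ ((hdw.clm_apply (hX.smooth_X k)).add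
      (contDiffOn_const.smul (hdw.clm_apply (H.smooth_J.clm_apply (hX.smooth_X k))))))
  skew x hx := H.frameConnection_add_conjForm hX hx
  structure_eq x hx j v u := by
    have hϑj : ϑ j =ᶠ[𝓝 x] innerForm (g j) z := by
      filter_upwards [H.eventually_mem hx] with y hy
      exact ContinuousLinearMap.ext (hϑ y hy j)
    have htors : ∀ a, torsionForm ϑ (fun j k x => 1 / 2 * ⟪g j x, dbar J w x (X k x)⟫_ℂ) j x a
        = ∑ k, 1 / 2 * ⟪g j x, dbar J w x (X k x)⟫_ℂ * ⟪fderiv ℝ z x a, g k x⟫_ℂ := fun a => by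
      simp [torsionForm, conjForm, hϑ x hx]
    rw [dForm_congr hϑj,
      dForm_innerForm (H.differentiableAt hx (hX.smooth_g j)) (H.contDiffAt hx H.smooth_z)]
    simp only [wedge, hϑ x hx, Finset.sum_sub_distrib, H.sum_inner_dz_mul_frameConnection hX hx,
      htors, H.sum_inner_dbar_mul hX hx, toComplexForm, ContinuousLinearMap.comp_apply,
      Complex.ofRealCLM_apply]
    ring

section Curvature

variable (hD : ∀ y ∈ V, ∀ u, θ y u = 0 → dbar J w y u = 0)

include hD

theorem inner_frame_dw (j : Fin m) {a : PHModel m} (ha : θ x a = 0) :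
    ⟪g j x, fderiv ℝ w x a⟫_ℂ
      = Complex.I * ((‖w x‖ ^ 2 : ℝ) : ℂ) * ⟪g j x, fderiv ℝ z x a⟫_ℂ := by
  rw [H.inner_dw hx ha (H.inner_w_g hX hx j), hD x hx a ha, inner_zero_right, mul_zero, add_zero]

theorem sum_frameConnection_mul (k j : Fin m) {a b : PHModel m} (ha : θ x a = 0)
    (hb : θ x b = 0) :
    ∑ l, frameConnection θ w g k l x a * frameConnection θ w g l j x b
      = -⟪fderiv ℝ (g j) x b, fderiv ℝ (g k) x a⟫_ℂ
        + ((‖w x‖ ^ 2 : ℝ) : ℂ) * ⟪g j x, fderiv ℝ z x b⟫_ℂ * conj ⟪g k x, fderiv ℝ z x a⟫_ℂ := by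
  have hwg : ⟪w x, fderiv ℝ (g k) x a⟫_ℂ
      = Complex.I * ((‖w x‖ ^ 2 : ℝ) : ℂ) * conj ⟪g k x, fderiv ℝ z x a⟫_ℂ := by
    rw [← inner_conj_symm, H.inner_fderiv_frame_w hx hX, H.inner_frame_dw hX hx hD k ha]
    simp
  simp only [frameConnection_apply, ha, hb, Complex.ofReal_zero, mul_zero, sub_zero,
    H.sum_inner_mul_inner_fderiv_frame hx hX, hwg, H.inner_frame_dw hX hx hD j hb]
  field_simp
  linear_combination (-⟪g j x, fderiv ℝ z x b⟫_ℂ * conj ⟪g k x, fderiv ℝ z x a⟫_ℂ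
    * ((‖w x‖ ^ 2 : ℝ) : ℂ)) * Complex.I_sq

omit hD in
theorem dForm_frameConnection (k j : Fin m) {v u : PHModel m} (hv : θ x v = 0) (hu : θ x u = 0) :
    dForm (frameConnection θ w g k j) x v u
      = ⟪fderiv ℝ (g j) x v, fderiv ℝ (g k) x u⟫_ℂ - ⟪fderiv ℝ (g j) x u, fderiv ℝ (g k) x v⟫_ℂ
        - (if j = k then Complex.I * ((‖w x‖ ^ 2 : ℝ) : ℂ) else 0)
          * ((dForm θ x v u : ℝ) : ℂ) := by
  have hc := H.differentiableAt hx (H.smooth_ite_norm_sq j k)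
  have hθ := H.differentiableAt hx H.smooth_toComplexForm
  have hg := H.differentiableAt hx
    (contDiffOn_innerForm H.isOpen (hX.smooth_g j) (hX.smooth_g k))
  have h := dForm_sub hg (hc.fun_smul hθ) v u
  rw [dForm_innerForm (H.differentiableAt hx (hX.smooth_g j)) (H.contDiffAt hx (hX.smooth_g k)),
    dForm_smul hc hθ, dForm_toComplexForm (H.differentiableAt hx H.smooth_θ)] at h
  refine h.trans ?_
  simp [toComplexForm, hv, hu]

theorem curvature_frameConnection (hϑ : IsAdmissibleCoframe V θ J ϑ)
    (hϑg : ∀ x ∈ V, ∀ k v, ϑ k x v = ⟪g k x, fderiv ℝ z x v⟫_ℂ) (k j : Fin m)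
    {v u : PHModel m} (hv : θ x v = 0) (hu : θ x u = 0) :
    dForm (frameConnection θ w g k j) x v u
      - ∑ l, wedge (frameConnection θ w g k l x) (frameConnection θ w g l j x) v u
      = ((‖w x‖ ^ 2 : ℝ) : ℂ) * (wedge (ϑ j x) (conjForm (ϑ k x)) v u
        + if j = k then ∑ p, wedge (ϑ p x) (conjForm (ϑ p x)) v u else 0) := by
  have hwedge : wedge (ϑ j x) (conjForm (ϑ k x)) v u
      = ⟪g j x, fderiv ℝ z x v⟫_ℂ * conj ⟪g k x, fderiv ℝ z x u⟫_ℂ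
        - ⟪g j x, fderiv ℝ z x u⟫_ℂ * conj ⟪g k x, fderiv ℝ z x v⟫_ℂ := by
    simp [wedge, conjForm, hϑg x hx]
  have hsum : ∑ l, wedge (frameConnection θ w g k l x) (frameConnection θ w g l j x) v u
      = ∑ l, frameConnection θ w g k l x v * frameConnection θ w g l j x u
        - ∑ l, frameConnection θ w g k l x u * frameConnection θ w g l j x v :=
    Finset.sum_sub_distrib ..
  rw [H.dForm_frameConnection hX hx k j hv hu, hsum, H.sum_frameConnection_mul hX hx hD k j hv hu,
    H.sum_frameConnection_mul hX hx hD k j hu hv, hwedge, hϑ.levi x hx]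
  split_ifs
  · linear_combination -((‖w x‖ ^ 2 : ℝ) : ℂ)
      * (∑ p, wedge (ϑ p x) (conjForm (ϑ p x)) v u) * Complex.I_sq
  · ring

end Curvature

end IsContactHypersurface

end Connection

section Uniqueness

variable {m : ℕ} {V : Set (PHModel m)} {θ : PHModel m → PHModel m →L[ℝ] ℝ}
  {J : PHModel m → PHModel m →L[ℝ] PHModel m} {ϑ : Fin m → PHModel m → PHModel m →L[ℝ] ℂ}
  {φ ψ : Fin m → Fin m → PHModel m → PHModel m →L[ℝ] ℂ} {A B : Fin m → Fin m → PHModel m → ℂ}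
  {R R' : Fin m → Fin m → Fin m → Fin m → PHModel m → ℂ}

namespace IsAdmissibleCoframe

variable (hϑ : IsAdmissibleCoframe V θ J ϑ) {x : PHModel m} (hx : x ∈ V)

include hϑ hx

theorem eq_zero_of_sum_mul_eq_zero {a : Fin m → PHModel m →L[ℝ] ℂ} {c : Fin m → ℂ}
    {ξ : PHModel m} (h : ∀ v, θ x v = 0 → ∑ k, c k * conj (ϑ k x v) = ∑ k, ϑ k x v * a k ξ)
    (l : Fin m) : a l ξ = 0 ∧ c l = 0 := by
  obtain ⟨X, hθX, hX⟩ := hϑ.exists_eq hx 0 (Pi.single l 1)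
  obtain ⟨Y, hθY, hY⟩ := hϑ.exists_eq hx 0 (Pi.single l Complex.I)
  have h1 := h X hθX
  have hI := h Y hθY
  simp only [hX, hY, Pi.single_apply, apply_ite conj, map_one, map_zero, Complex.conj_I, mul_ite,
    ite_mul, mul_one, one_mul, mul_zero, zero_mul, Finset.sum_ite_eq', Finset.mem_univ,
    if_true] at h1 hI
  have hc : c l = 0 := by
    linear_combination h1 / 2 + Complex.I / 2 * hI + (c l + a l ξ) / 2 * Complex.I_sq
  exact ⟨by rw [← h1, hc], hc⟩

theorem eq_zero_of_skew_of_symm {a : Fin m → Fin m → PHModel m →L[ℝ] ℂ}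
    (hskew : ∀ k j v, a k j v = -conj (a j k v))
    (hsymm : ∀ j u v, θ x u = 0 → θ x v = 0 →
      ∑ k, ϑ k x u * a k j v = ∑ k, ϑ k x v * a k j u) (l j : Fin m) {u : PHModel m}
    (hu : θ x u = 0) : a l j u = 0 := by
  choose X hθX hX using fun l => hϑ.exists_eq hx 0 (Pi.single l 1)
  choose Y hθY hY using fun l => hϑ.exists_eq hx 0 (Pi.single l Complex.I)
  have hexpand : ∀ l j u, θ x u = 0 → a l j u = ∑ k, ϑ k x u * a k j (X l) := fun l j u hu => by
    simpa [hX, Pi.single_apply] using hsymm j (X l) u (hθX l) hu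
  -- `a l j` is complex linear and, being skew-Hermitian, also conjugate linear.
  have hXY : ∀ l j p, a l j (Y p) = Complex.I * a l j (X p) := fun l j p => by
    rw [hexpand l j _ (hθY p), hexpand l j _ (hθX p)]
    simp [hX, hY, Pi.single_apply]
  have hX0 : ∀ l j p, a l j (X p) = 0 := fun l j p => by
    have h := hskew l j (Y p)
    rw [hXY l j, hXY j l, map_mul, Complex.conj_I, neg_mul, neg_neg] at h
    have hconj : a l j (X p) = conj (a j l (X p)) := mul_left_cancel₀ Complex.I_ne_zero h
    linear_combination hskew l j (X p) / 2 + hconj / 2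
  rw [hexpand l j u hu]
  simp [hX0]

theorem eq_of_sum_wedge_eq {r s : Fin m → Fin m → ℂ}
    (h : ∀ v u, θ x v = 0 → θ x u = 0 → ∑ p, ∑ q, r p q * wedge (ϑ p x) (conjForm (ϑ q x)) v u
      = ∑ p, ∑ q, s p q * wedge (ϑ p x) (conjForm (ϑ q x)) v u) (p q : Fin m) :
    r p q = s p q := by
  obtain ⟨X, hθX, hX⟩ := hϑ.exists_eq hx 0 (Pi.single p 1)
  obtain ⟨Y, hθY, hY⟩ := hϑ.exists_eq hx 0 (Pi.single p Complex.I)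
  obtain ⟨Z, hθZ, hZ⟩ := hϑ.exists_eq hx 0 (Pi.single q 1)
  have h1 := h X Z hθX hθZ
  have hI := h Y Z hθY hθZ
  simp only [wedge, conjForm, ContinuousLinearMap.comp_apply, ContinuousLinearEquiv.coe_coe,
    Complex.conjCLE_apply, hX, hY, hZ, Pi.single_apply, apply_ite conj, map_one, map_zero,
    Complex.conj_I, mul_ite, ite_mul, mul_one, one_mul, mul_zero, zero_mul, mul_sub,
    Finset.sum_sub_distrib, Finset.sum_ite_eq', Finset.mem_univ, if_true] at h1 hI
  have hI' := mul_left_cancel₀ Complex.I_ne_zero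
    (by linear_combination hI : Complex.I * (r p q + r q p) = Complex.I * (s p q + s q p))
  linear_combination (h1 + hI') / 2

end IsAdmissibleCoframe

namespace IsConnection

variable (hϑ : IsAdmissibleCoframe V θ J ϑ) (hφ : IsConnection V θ ϑ φ A)
  (hψ : IsConnection V θ ϑ ψ B) {x : PHModel m} (hx : x ∈ V)

include hφ hψ hx

theorem sum_wedge_sub (j : Fin m) (v u : PHModel m) :
    ∑ k, (ϑ k x v * (φ k j x - ψ k j x) u - ϑ k x u * (φ k j x - ψ k j x) v)
      + (θ x v * ∑ k, (A j k x - B j k x) * conj (ϑ k x u)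
        - θ x u * ∑ k, (A j k x - B j k x) * conj (ϑ k x v)) = 0 := by
  have h := (hφ.structure_eq x hx j v u).symm.trans (hψ.structure_eq x hx j v u)
  simp only [wedge, torsionForm, toComplexForm, conjForm, sum_apply, smul_apply, smul_eq_mul,
    ContinuousLinearMap.comp_apply, ContinuousLinearEquiv.coe_coe, Complex.conjCLE_apply,
    Complex.ofRealCLM_apply, Finset.sum_sub_distrib, sub_apply, mul_sub, sub_mul] at h ⊢
  linear_combination h

theorem sub_skew (k j : Fin m) (v : PHModel m) :
    (φ k j x - ψ k j x) v = -conj ((φ j k x - ψ j k x) v) := by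
  have hφv := DFunLike.congr_fun (hφ.skew x hx k j) v
  have hψv := DFunLike.congr_fun (hψ.skew x hx k j) v
  simp only [add_apply, conjForm, ContinuousLinearMap.comp_apply, ContinuousLinearEquiv.coe_coe,
    Complex.conjCLE_apply, zero_apply] at hφv hψv
  rw [sub_apply, sub_apply, map_sub]
  linear_combination hφv - hψv

include hϑ

theorem unique : (∀ k j, φ k j x = ψ k j x) ∧ ∀ j k, A j k x = B j k x := by
  obtain ⟨ξ, hξ, hϑξ⟩ := hϑ.exists_eq hx 1 fun _ => 0
  have hvert : ∀ j k, (φ k j x - ψ k j x) ξ = 0 ∧ A j k x - B j k x = 0 := fun j =>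
    hϑ.eq_zero_of_sum_mul_eq_zero hx (a := fun k => φ k j x - ψ k j x)
      (c := fun k => A j k x - B j k x) fun v hv => by
        have h := sum_wedge_sub hφ hψ hx j ξ v
        simp only [hξ, hϑξ, hv, Complex.ofReal_one, Complex.ofReal_zero, zero_mul, zero_sub,
          sub_zero, one_mul, Finset.sum_neg_distrib] at h
        linear_combination h
  have hhor : ∀ k j u, θ x u = 0 → (φ k j x - ψ k j x) u = 0 := fun k j u hu =>
    hϑ.eq_zero_of_skew_of_symm hx (a := fun k j => φ k j x - ψ k j x) (sub_skew hφ hψ hx)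
      (fun j u v hu hv => by
        have h := sum_wedge_sub hφ hψ hx j u v
        simp only [hu, hv, Complex.ofReal_zero, zero_mul, sub_zero, add_zero,
          Finset.sum_sub_distrib] at h
        exact sub_eq_zero.1 h) k j hu
  refine ⟨fun k j => sub_eq_zero.1 (ContinuousLinearMap.ext fun v => ?_),
    fun j k => sub_eq_zero.1 (hvert j k).2⟩
  have h := hhor k j (v - θ x v • ξ) (by simp [hξ])
  rwa [map_sub, map_smul, (hvert j k).1, smul_zero, sub_zero] at h

end IsConnection

theorem IsCurvature.unique (hV : IsOpen V) (hϑ : IsAdmissibleCoframe V θ J ϑ)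
    (hφ : IsConnection V θ ϑ φ A) (hψ : IsConnection V θ ϑ ψ B) (hR : IsCurvature V θ ϑ φ A R)
    (hR' : IsCurvature V θ ϑ ψ B R') {x : PHModel m} (hx : x ∈ V) (k j p q : Fin m) :
    R k j p q x = R' k j p q x := by
  have hφψ : ∀ k j, φ k j =ᶠ[𝓝 x] ψ k j := fun k j => by
    filter_upwards [hV.mem_nhds hx] with y hy using (hφ.unique hϑ hψ hy).1 k j
  have htors : ∀ j, torsionForm ϑ A j x = torsionForm ϑ B j x := fun j => by
    simp only [torsionForm, (hφ.unique hϑ hψ hx).2]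
  refine hϑ.eq_of_sum_wedge_eq hx (r := fun p q => R k j p q x) (s := fun p q => R' k j p q x)
    (fun v u hv hu => ?_) p q
  have h := hR x hx k j v u hv hu
  simp only [dForm_congr (hφψ k j), (hφψ _ _).eq_of_nhds, htors] at h
  linear_combination hR' x hx k j v u hv hu - h

end Uniqueness

namespace IsContactHypersurface

section TorsionCurvature

variable {m : ℕ} {W : Type*} [NormedAddCommGroup W] [InnerProductSpace ℂ W] [NormedSpace ℝ W]
  [IsScalarTower ℝ ℂ W]
  {V : Set (PHModel m)} {θ : PHModel m → PHModel m →L[ℝ] ℝ}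
  {J : PHModel m → PHModel m →L[ℝ] PHModel m} {z w : PHModel m → W} {ξ : PHModel m → PHModel m}
  {ϑ : Fin m → PHModel m → PHModel m →L[ℝ] ℂ}
  {φ : Fin m → Fin m → PHModel m → PHModel m →L[ℝ] ℂ} {A : Fin m → Fin m → PHModel m → ℂ}
  {R : Fin m → Fin m → Fin m → Fin m → PHModel m → ℂ}
  (H : IsContactHypersurface V θ J z w ξ) (hϑ : IsAdmissibleCoframe V θ J ϑ)
  (hφ : IsConnection V θ ϑ φ A) {x : PHModel m} (hx : x ∈ V)

include H hϑ

theorem exists_isConnection : ∃ φ A, IsConnection V θ ϑ φ A := by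
  obtain ⟨X, g, hX, hϑg⟩ := H.exists_unitaryFrame hϑ
  exact ⟨_, _, H.isConnection_frameConnection hX hϑg⟩

include hφ hx in
theorem torsion_eq_zero_iff :
    (∀ j k, A j k x = 0) ↔ ∀ v, θ x v = 0 → dbar J w x v = 0 := by
  obtain ⟨X, g, hX, hϑg⟩ := H.exists_unitaryFrame hϑ
  simp only [(hφ.unique hϑ (H.isConnection_frameConnection hX hϑg) hx).2]
  refine ⟨fun h v hv => ?_, fun h j k => by rw [h _ (hX.θ_X x hx k), inner_zero_right, mul_zero]⟩
  rw [H.dbar_eq_sum hx hX hv]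
  refine Finset.sum_eq_zero fun k _ => ?_
  rw [eq_sum_of_orthonormal H.finrank_complex (H.w_ne hx) (hX.orthonormal x hx)
    (H.inner_w_g hX hx) (dbar J w x (X k x)), H.inner_w_dbar hx (hX.θ_X x hx k)]
  have hinner : ∀ j, ⟪g j x, dbar J w x (X k x)⟫_ℂ = 0 := fun j => by simpa using h j k
  simp [hinner]

theorem exists_isCurvature (hD : ∀ y ∈ V, ∀ u, θ y u = 0 → dbar J w y u = 0) :
    ∃ φ A, IsConnection V θ ϑ φ A ∧ IsCurvature V θ ϑ φ A fun k j p q x =>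
      ((‖w x‖ ^ 2 : ℝ) : ℂ) * ((if j = p then if k = q then 1 else 0 else 0)
        + if j = k then if p = q then 1 else 0 else 0) := by
  obtain ⟨X, g, hX, hϑg⟩ := H.exists_unitaryFrame hϑ
  have hconn := H.isConnection_frameConnection hX hϑg
  refine ⟨_, _, hconn, fun x hx k j v u hv hu => ?_⟩
  have htors : ∀ j, torsionForm ϑ (fun j k x => 1 / 2 * ⟪g j x, dbar J w x (X k x)⟫_ℂ) j x = 0 :=
    fun j => Finset.sum_eq_zero fun k _ => by
      beta_reduce
      rw [(H.torsion_eq_zero_iff hϑ hconn hx).2 (hD x hx) j k]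
      exact zero_smul ℂ (conjForm (ϑ k x))
  have hconj : conjForm (0 : PHModel m →L[ℝ] ℂ) = 0 := ContinuousLinearMap.comp_zero _
  rw [H.curvature_frameConnection hX hx hD hϑ hϑg k j hv hu, htors, htors, hconj]
  have hwedge : ∀ a : PHModel m →L[ℝ] ℂ, wedge a 0 v u = 0 ∧ wedge 0 a v u = 0 := fun a => by
    simp [wedge]
  simp only [hwedge, mul_zero, add_zero, sub_zero, mul_add, add_mul, Finset.sum_add_distrib,
    mul_ite, ite_mul, mul_one, zero_mul]
  split_ifs <;> simp [Finset.mul_sum]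

include hφ hx in
theorem sum_curvature (hR : IsCurvature V θ ϑ φ A R)
    (hD : ∀ y ∈ V, ∀ u, θ y u = 0 → dbar J w y u = 0) :
    ∑ k, ∑ l, R k k l l x = ((m * (m + 1) * ‖w x‖ ^ 2 : ℝ) : ℂ) := by
  obtain ⟨ψ, B, hψ, hR'⟩ := H.exists_isCurvature hϑ hD
  simp only [hR.unique H.isOpen hϑ hφ hψ hR' hx, if_true, ← Finset.mul_sum,
    Finset.sum_add_distrib]
  simp only [Complex.ofReal_pow, Finset.sum_ite_eq, Finset.mem_univ, ↓reduceIte,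
    Finset.sum_const, Finset.card_univ, Fintype.card_fin, nsmul_eq_mul, mul_one,
    Complex.ofReal_mul, Complex.ofReal_natCast, Complex.ofReal_add, Complex.ofReal_one]
  ring

end TorsionCurvature

end IsContactHypersurface

section Tilt

variable {W : Type*} [NormedAddCommGroup W] [InnerProductSpace ℂ W] {a b : W}

/-- For unit vectors `a` and `b` with `⟪b, a⟫ ≠ -1`, the unitary map from `aᗮ` to `bᗮ` that fixes
the vectors orthogonal to both. It carries an orthonormal basis along with `b` smoothly. -/
def unitaryTilt (a b h : W) : W := h - (⟪b, h⟫_ℂ / (1 + ⟪b, a⟫_ℂ)) • (a + b)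

theorem inner_unitaryTilt (ha : ⟪a, a⟫_ℂ = 1) (hb : ⟪b, b⟫_ℂ = 1) (hba : 1 + ⟪b, a⟫_ℂ ≠ 0)
    {h k : W} (hh : ⟪a, h⟫_ℂ = 0) (hk : ⟪a, k⟫_ℂ = 0) :
    ⟪unitaryTilt a b h, unitaryTilt a b k⟫_ℂ = ⟪h, k⟫_ℂ := by
  have hab : 1 + ⟪a, b⟫_ℂ ≠ 0 := fun h0 => hba (by simpa using congrArg conj h0)
  simp only [unitaryTilt, inner_sub_left, inner_sub_right, inner_smul_left, inner_smul_right,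
    inner_add_left, inner_add_right, ha, hb, hk, inner_eq_zero_symm.1 hh, map_div₀, map_add,
    map_one, inner_conj_symm]
  field_simp
  ring

theorem inner_unitaryTilt_right (hb : ⟪b, b⟫_ℂ = 1) (hba : 1 + ⟪b, a⟫_ℂ ≠ 0) (h : W) :
    ⟪b, unitaryTilt a b h⟫_ℂ = 0 := by
  rw [unitaryTilt, inner_sub_right, inner_smul_right, inner_add_right, hb]
  field_simp
  ring

theorem contDiffOn_unitaryTilt [NormedSpace ℝ W] {E : Type*} [NormedAddCommGroup E]
    [NormedSpace ℝ E] {V : Set E} {b : E → W} (hb : ContDiffOn ℝ ∞ b V)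
    (hba : ∀ y ∈ V, 1 + ⟪b y, a⟫_ℂ ≠ 0) (h : W) :
    ContDiffOn ℝ ∞ (fun y => unitaryTilt a (b y) h) V := by
  have hinner : ∀ k : W, ContDiffOn ℝ ∞ (fun y => ⟪b y, k⟫_ℂ) V := fun k =>
    hb.inner ℂ contDiffOn_const
  have hcoef : ContDiffOn ℝ ∞ (fun y => ⟪b y, h⟫_ℂ / (1 + ⟪b y, a⟫_ℂ)) V := by
    simp only [div_eq_mul_inv]
    exact (hinner h).mul ((contDiffOn_const.add (hinner a)).inv hba)
  exact contDiffOn_const.sub (hcoef.smul (contDiffOn_const.add hb))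

theorem exists_orthonormal_inner_eq_zero {m : ℕ} (hm : Module.finrank ℂ W = m + 1) (ha : a ≠ 0) :
    ∃ e : Fin m → W, Orthonormal ℂ e ∧ ∀ k, ⟪a, e k⟫_ℂ = 0 := by
  have : Fact (Module.finrank ℂ W = m + 1) := ⟨hm⟩
  let B := OrthonormalBasis.fromOrthogonalSpanSingleton (𝕜 := ℂ) m ha
  exact ⟨fun k => B k, B.orthonormal.comp_linearIsometry (Submodule.subtypeₗᵢ _),
    fun k => Submodule.mem_orthogonal_singleton_iff_inner_right.1 (B k).2⟩

theorem exists_orthonormal_contDiffOn [NormedSpace ℝ W] {E : Type*} [NormedAddCommGroup E]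
    [NormedSpace ℝ E] {V : Set E} (hV : IsOpen V) {m : ℕ} (hm : Module.finrank ℂ W = m + 1)
    {w : E → W} (hw : ContDiffOn ℝ ∞ w V) (hw0 : ∀ y ∈ V, w y ≠ 0) {x : E} (hx : x ∈ V) :
    ∃ V' ⊆ V, IsOpen V' ∧ x ∈ V' ∧ ∃ g : Fin m → E → W, (∀ k, ContDiffOn ℝ ∞ (g k) V') ∧
      (∀ y ∈ V', Orthonormal ℂ fun k => g k y) ∧ ∀ y ∈ V', ∀ k, ⟪w y, g k y⟫_ℂ = 0 := by
  let b : E → W := fun y => (‖w y‖⁻¹ : ℂ) • w y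
  have hb_smooth : ContDiffOn ℝ ∞ b V :=
    (Complex.ofRealCLM.contDiff.comp_contDiffOn (hw.norm ℂ hw0) |>.inv fun y hy => by
      simpa using hw0 y hy).smul hw
  have hb : ∀ y ∈ V, ⟪b y, b y⟫_ℂ = 1 := fun y hy => by
    have : (‖w y‖ : ℂ) ≠ 0 := by simpa using hw0 y hy
    simp only [b, inner_smul_left, inner_smul_right, inner_self_eq_ofReal, map_inv₀,
      Complex.conj_ofReal]
    push_cast
    field_simp
  have hwb : ∀ y ∈ V, w y = (‖w y‖ : ℂ) • b y := fun y hy =>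
    (smul_inv_smul₀ (by simpa using hw0 y hy) (w y)).symm
  obtain ⟨e, he, hae⟩ := exists_orthonormal_inner_eq_zero hm
    (a := b x) fun h => by simpa [h] using hb x hx
  have hD_smooth : ContDiffOn ℝ ∞ (fun y => 1 + ⟪b y, b x⟫_ℂ) V :=
    contDiffOn_const.add (hb_smooth.inner ℂ contDiffOn_const)
  refine ⟨V ∩ (fun y => 1 + ⟪b y, b x⟫_ℂ) ⁻¹' {0}ᶜ, inter_subset_left,
    hD_smooth.continuousOn.isOpen_inter_preimage hV isOpen_compl_singleton,
    ⟨hx, by simp [-inner_self_eq_norm_sq_to_K, hb x hx, one_add_one_eq_two]⟩,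
    fun k y => unitaryTilt (b x) (b y) (e k),
    fun k => contDiffOn_unitaryTilt (hb_smooth.mono inter_subset_left) (fun y hy => hy.2) (e k),
    fun y hy => orthonormal_iff_ite.2 fun j k => ?_, fun y hy k => ?_⟩
  · rw [inner_unitaryTilt (hb x hx) (hb y hy.1) hy.2 (hae j) (hae k), orthonormal_iff_ite.1 he]
  · rw [hwb y hy.1, inner_smul_left, inner_unitaryTilt_right (hb y hy.1) hy.2, mul_zero]

end Tilt

namespace IsContactHypersurface

variable {m : ℕ} {W : Type*} [NormedAddCommGroup W] [InnerProductSpace ℂ W] [NormedSpace ℝ W]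

theorem mono {E : Type*} [NormedAddCommGroup E] [NormedSpace ℝ E] {V V' : Set E}
    {θ : E → E →L[ℝ] ℝ} {J : E → E →L[ℝ] E} {z w : E → W} {ξ : E → E}
    (H : IsContactHypersurface V θ J z w ξ) (hV' : IsOpen V') (h : V' ⊆ V) :
    IsContactHypersurface V' θ J z w ξ where
  isOpen := hV'
  codim_one := H.codim_one
  smooth_z := H.smooth_z.mono h
  smooth_θ := H.smooth_θ.mono h
  smooth_J := H.smooth_J.mono h
  dθ x hx := H.dθ x (h hx)
  θ_ξ x hx := H.θ_ξ x (h hx)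
  z_ξ x hx := H.z_ξ x (h hx)
  θ_J x hx := H.θ_J x (h hx)
  z_J x hx := H.z_J x (h hx)
  orth x hx := H.orth x (h hx)
  inj x hx := H.inj x (h hx)

theorem exists_isAdmissibleCoframe [IsScalarTower ℝ ℂ W] {V : Set (PHModel m)}
    {θ : PHModel m → PHModel m →L[ℝ] ℝ} {J : PHModel m → PHModel m →L[ℝ] PHModel m}
    {z w : PHModel m → W} {ξ : PHModel m → PHModel m} (H : IsContactHypersurface V θ J z w ξ)
    {x : PHModel m} (hx : x ∈ V) :
    ∃ V' ⊆ V, IsOpen V' ∧ x ∈ V' ∧ ∃ ϑ, IsAdmissibleCoframe V' θ J ϑ := by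
  obtain ⟨V', hV'V, hV', hxV', g, hg_smooth, hg, hwg⟩ := exists_orthonormal_contDiffOn H.isOpen
    H.finrank_complex H.smooth_w (fun _ hy => H.w_ne hy) hx
  exact ⟨V', hV'V, hV', hxV', _, (H.mono hV' hV'V).isAdmissibleCoframe_innerForm hg_smooth hg hwg⟩

end IsContactHypersurface

section Charts

variable {m : ℕ} {M : Type*} [TopologicalSpace M] [ChartedSpace (PHModel m) M]
  {e : OpenPartialHomeomorph M (PHModel m)}
  (he : e ∈ IsManifold.maximalAtlas 𝓘(ℝ, PHModel m) ∞ M) {x : PHModel m} (hx : x ∈ e.target)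

/-- The tangent vector of `M` with coordinates `v` in the chart `e`. -/
def chartLift (e : OpenPartialHomeomorph M (PHModel m)) (x v : PHModel m) :
    TangentSpace 𝓘(ℝ, PHModel m) (e.symm x) :=
  mfderiv 𝓘(ℝ, PHModel m) 𝓘(ℝ, PHModel m) e.symm x v

/-- The coordinates of a tangent vector of `M` in the chart `e`. -/
def chartCoord (e : OpenPartialHomeomorph M (PHModel m)) (p : M)
    (v : TangentSpace 𝓘(ℝ, PHModel m) p) : PHModel m :=
  mfderiv 𝓘(ℝ, PHModel m) 𝓘(ℝ, PHModel m) e p v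

include he

theorem contDiffOn_comp_symm {F : Type*} [NormedAddCommGroup F] [NormedSpace ℝ F] {h : M → F}
    (hh : ContMDiff 𝓘(ℝ, PHModel m) 𝓘(ℝ, F) ∞ h) : ContDiffOn ℝ ∞ (h ∘ e.symm) e.target :=
  contMDiffOn_iff_contDiffOn.1 (hh.comp_contMDiffOn (contMDiffOn_symm_of_mem_maximalAtlas he))

theorem mdifferentiable_of_mem_maximalAtlas :
    e.MDifferentiable 𝓘(ℝ, PHModel m) 𝓘(ℝ, PHModel m) :=
  ⟨(contMDiffOn_of_mem_maximalAtlas he).mdifferentiableOn (by simp),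
    (contMDiffOn_symm_of_mem_maximalAtlas he).mdifferentiableOn (by simp)⟩

include hx

theorem chartLift_chartCoord (v : TangentSpace 𝓘(ℝ, PHModel m) (e.symm x)) :
    chartLift e x (chartCoord e (e.symm x) v) = v := by
  have h := DFunLike.congr_fun
    ((mdifferentiable_of_mem_maximalAtlas he).symm_comp_deriv (e.map_target hx)) v
  rw [e.right_inv hx] at h
  exact h

theorem chartCoord_chartLift (v : PHModel m) : chartCoord e (e.symm x) (chartLift e x v) = v :=
  DFunLike.congr_fun ((mdifferentiable_of_mem_maximalAtlas he).comp_symm_deriv hx) v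

theorem fderiv_comp_symm {F : Type*} [NormedAddCommGroup F] [NormedSpace ℝ F] {h : M → F}
    (hh : MDifferentiableAt 𝓘(ℝ, PHModel m) 𝓘(ℝ, F) h (e.symm x)) (v : PHModel m) :
    fderiv ℝ (h ∘ e.symm) x v
      = mfderiv 𝓘(ℝ, PHModel m) 𝓘(ℝ, F) h (e.symm x) (chartLift e x v) := by
  rw [← mfderiv_eq_fderiv, mfderiv_comp x hh
    ((mdifferentiable_of_mem_maximalAtlas he).mdifferentiableAt_symm hx)]
  rfl

theorem chartLift_endoInChart
    (J : ∀ p : M, TangentSpace 𝓘(ℝ, PHModel m) p →L[ℝ] TangentSpace 𝓘(ℝ, PHModel m) p)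
    (v : PHModel m) : chartLift e x (endoInChart e J x v) = J (e.symm x) (chartLift e x v) :=
  chartLift_chartCoord he hx (J (e.symm x) (chartLift e x v))

omit he hx in
theorem formInChart_apply (α : ∀ p : M, TangentSpace 𝓘(ℝ, PHModel m) p →L[ℝ] ℝ)
    (e : OpenPartialHomeomorph M (PHModel m)) (x v : PHModel m) :
    formInChart e α x v = α (e.symm x) (chartLift e x v) := rfl

end Charts

section ChartComponents

variable {m n : ℕ} {M : Type*} [TopologicalSpace M] [ChartedSpace (PHModel m) M]
  {e : OpenPartialHomeomorph M (PHModel m)}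

/-- The `ℂⁿ`-component of a map to the Heisenberg group in a chart. -/
def zChart (e : OpenPartialHomeomorph M (PHModel m)) (f : M → Heis n) (x : PHModel m) :
    EuclideanSpace ℂ (Fin n) := (f (e.symm x)).1

/-- The `ℝ`-component of a map to the Heisenberg group in a chart. -/
def tChart (e : OpenPartialHomeomorph M (PHModel m)) (f : M → Heis n) (x : PHModel m) : ℝ :=
  (f (e.symm x)).2

variable (he : e ∈ IsManifold.maximalAtlas 𝓘(ℝ, PHModel m) ∞ M) {f : M → Heis n}
  (hf : ContMDiff 𝓘(ℝ, PHModel m) 𝓘(ℝ, Heis n) ∞ f)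

include he hf

theorem contDiffOn_zChart : ContDiffOn ℝ ∞ (zChart e f) e.target :=
  contDiff_fst.comp_contDiffOn (contDiffOn_comp_symm he hf)

theorem contDiffOn_tChart : ContDiffOn ℝ ∞ (tChart e f) e.target :=
  contDiff_snd.comp_contDiffOn (contDiffOn_comp_symm he hf)

theorem diffAt_chartLift {x : PHModel m} (hx : x ∈ e.target) (v : PHModel m) :
    diffAt f (e.symm x) (chartLift e x v)
      = (fderiv ℝ (zChart e f) x v, fderiv ℝ (tChart e f) x v) := by
  have hz := differentiableAt_of_contDiffOn (contDiffOn_zChart he hf) e.open_target hx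
  have ht := differentiableAt_of_contDiffOn (contDiffOn_tChart he hf) e.open_target hx
  have h := fderiv_comp_symm he hx (hf.mdifferentiableAt (by simp)) v
  rw [show f ∘ e.symm = fun y => (zChart e f y, tChart e f y) from rfl,
    (hz.hasFDerivAt.prodMk ht.hasFDerivAt).fderiv] at h
  exact h.symm

end ChartComponents

section Submanifold

variable {m n : ℕ} {M : Type*} [TopologicalSpace M] [ChartedSpace (PHModel m) M]
  [IsManifold 𝓘(ℝ, PHModel m) ∞ M] {S : PseudohermitianStructure m M}
  {e : OpenPartialHomeomorph M (PHModel m)}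
  (he : e ∈ IsManifold.maximalAtlas 𝓘(ℝ, PHModel m) ∞ M) {x : PHModel m} (hx : x ∈ e.target)

namespace PseudohermitianStructure

include he hx in
theorem formInChart_endoInChart (v : PHModel m) :
    formInChart e S.θ x (endoInChart e S.J x v) = 0 := by
  rw [formInChart_apply, chartLift_endoInChart he hx, S.θ_J]

end PseudohermitianStructure

namespace IsPseudohermitianSubmanifold

variable {f : M → Heis n} (hf : IsPseudohermitianSubmanifold S f)

include he hf

include hx in
theorem formInChart_eq (v : PHModel m) : formInChart e S.θ x v
    = fderiv ℝ (tChart e f) x v + (⟪zChart e f x, fderiv ℝ (zChart e f) x v⟫_ℂ).im := by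
  rw [formInChart_apply, hf.θ_eq, diffAt_chartLift he hf.smooth hx]
  rfl

include hx in
theorem dForm_formInChart (u v : PHModel m) : dForm (formInChart e S.θ) x u v
    = 2 * (⟪fderiv ℝ (zChart e f) x u, fderiv ℝ (zChart e f) x v⟫_ℂ).im := by
  have hmem := e.open_target.mem_nhds hx
  have hz_smooth := contDiffOn_zChart he hf.smooth
  have hz := (hz_smooth.contDiffAt hmem).of_le (m := 2) (WithTop.coe_le_coe.2 le_top)
  have ht := ((contDiffOn_tChart he hf.smooth).contDiffAt hmem).of_le (m := 2)
    (WithTop.coe_le_coe.2 le_top)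
  have hform := differentiableAt_of_contDiffOn
    (contDiffOn_innerForm e.open_target hz_smooth hz_smooth) e.open_target hx
  have hθ : formInChart e S.θ =ᶠ[𝓝 x] fun y => fderiv ℝ (tChart e f) y
      + Complex.imCLM.comp (innerForm (zChart e f) (zChart e f) y) := by
    filter_upwards [hmem] with y hy
    exact ContinuousLinearMap.ext (hf.formInChart_eq he hy)
  rw [dForm_congr hθ, dForm_add (ht.fderiv_right (m := 1) le_rfl |>.differentiableAt (by simp))
    ((differentiableAt_const _).clm_comp hform), dForm_fderiv ht,
    dForm_clm_comp _ hform,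
    dForm_innerForm (hz.differentiableAt (by simp)) hz, zero_add, map_sub, Complex.imCLM_apply,
    Complex.imCLM_apply, ← inner_conj_symm (fderiv ℝ (zChart e f) x v), Complex.conj_im]
  ring

include hx in
theorem fderiv_zChart_endoInChart {v : PHModel m} (hv : formInChart e S.θ x v = 0) :
    fderiv ℝ (zChart e f) x (endoInChart e S.J x v) = Complex.I • fderiv ℝ (zChart e f) x v := by
  have h := diffAt_chartLift he hf.smooth hx (endoInChart e S.J x v)
  rw [chartLift_endoInChart he hx, hf.J_eq _ (chartLift e x v) hv,
    diffAt_chartLift he hf.smooth hx] at h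
  exact (Prod.ext_iff.1 h).1.symm

include hx in
theorem eq_zero_of_fderiv_zChart_eq_zero {v : PHModel m} (hz : fderiv ℝ (zChart e f) x v = 0)
    (hv : formInChart e S.θ x v = 0) : v = 0 := by
  have ht : fderiv ℝ (tChart e f) x v = 0 := by
    simpa [hz, hv] using (hf.formInChart_eq he hx v).symm
  have hf_v := diffAt_chartLift he hf.smooth hx v
  rw [hz, ht] at hf_v
  have hlift : chartLift e x v = 0 :=
    hf.immersion _ (hf_v.trans (map_zero (diffAt f (e.symm x))).symm)
  rw [← chartCoord_chartLift he hx v, hlift]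
  exact map_zero (mfderiv 𝓘(ℝ, PHModel m) 𝓘(ℝ, PHModel m) e (e.symm x))

end IsPseudohermitianSubmanifold

end Submanifold

section FundamentalVectorField

variable {m n : ℕ} {M : Type*} [TopologicalSpace M] [ChartedSpace (PHModel m) M]
  [IsManifold 𝓘(ℝ, PHModel m) ∞ M] {S : PseudohermitianStructure m M}
  {e : OpenPartialHomeomorph M (PHModel m)}

namespace IsFundamentalVectorField

variable {f ν : M → Heis n} (hν : IsFundamentalVectorField S f ν)

include hν

theorem fst_ne_zero {p : M} (hp : ν p ≠ 0) : (ν p).1 ≠ 0 := fun h => hp <| Prod.ext h <| by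
  simpa [Heis.Θ, h] using (hν p).1

variable (hf : IsPseudohermitianSubmanifold S f)
  (he : e ∈ IsManifold.maximalAtlas 𝓘(ℝ, PHModel m) ∞ M) {x : PHModel m} (hx : x ∈ e.target)

include hf he hx

theorem exists_fderiv_zChart_eq :
    ∃ u, formInChart e S.θ x u = 1 ∧ fderiv ℝ (zChart e f) x u = zChart e ν x := by
  obtain ⟨hΘ, -, u, hu⟩ := hν (e.symm x)
  have hlift : diffAt f (e.symm x) (chartLift e x (chartCoord e (e.symm x) u))
      = Heis.T + ν (e.symm x) := by rw [chartLift_chartCoord he hx, hu]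
  refine ⟨chartCoord e (e.symm x) u, ?_, ?_⟩
  · rw [formInChart_apply, hf.θ_eq, hlift]
    rw [Heis.Θ] at hΘ ⊢
    rw [Heis.T, Prod.snd_add, Prod.fst_add, zero_add, add_assoc, hΘ, add_zero]
  · rw [diffAt_chartLift he hf.smooth hx] at hlift
    simpa [Heis.T, zChart] using (Prod.ext_iff.1 hlift).1

theorem inner_fderiv_zChart {v : PHModel m} (hv : formInChart e S.θ x v = 0) :
    ⟪zChart e ν x, fderiv ℝ (zChart e f) x v⟫_ℂ = 0 := by
  have hre : ∀ u, formInChart e S.θ x u = 0 →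
      (⟪zChart e ν x, fderiv ℝ (zChart e f) x u⟫_ℂ).re = 0 := by
    intro u hu
    have h := (hν (e.symm x)).2.1 (chartLift e x u) hu
    rwa [Heis.metric, (hν (e.symm x)).1, zero_mul, add_zero, diffAt_chartLift he hf.smooth hx] at h
  have hre_J := hre _ (S.formInChart_endoInChart he hx v)
  rw [hf.fderiv_zChart_endoInChart he hx hv, inner_smul_right] at hre_J
  exact Complex.ext (hre v hv) (by simpa using hre_J)

theorem eq_zero_of_fderiv_zChart (hp : ν (e.symm x) ≠ 0) {v : PHModel m}
    (hv : fderiv ℝ (zChart e f) x v = 0) : v = 0 := by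
  obtain ⟨u, hu, hzu⟩ := hν.exists_fderiv_zChart_eq hf he hx
  have h := hν.inner_fderiv_zChart hf he hx (v := v - formInChart e S.θ x v • u) (by simp [hu])
  rw [map_sub, map_smul, hv, hzu, zero_sub, inner_neg_right, inner_smul_right_eq_smul,
    neg_eq_zero, smul_eq_zero, inner_self_eq_zero] at h
  exact hf.eq_zero_of_fderiv_zChart_eq_zero he hx hv (h.resolve_right (hν.fst_ne_zero hp))

end IsFundamentalVectorField

theorem exists_isContactHypersurface {f ν : M → Heis (m + 1)}
    (he : e ∈ IsManifold.maximalAtlas 𝓘(ℝ, PHModel m) ∞ M) (hf : IsPseudohermitianSubmanifold S f)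
    (hν : IsFundamentalVectorField S f ν) (hν0 : ∀ p, ν p ≠ 0) :
    ∃ ξ, IsContactHypersurface e.target (formInChart e S.θ) (endoInChart e S.J) (zChart e f)
      (zChart e ν) ξ := by
  choose! ξ hξ using fun x (hx : x ∈ e.target) => hν.exists_fderiv_zChart_eq hf he hx
  exact ⟨ξ, {
    isOpen := e.open_target
    codim_one := by
      rw [← Module.finrank_mul_finrank ℝ ℂ (EuclideanSpace ℂ (Fin (m + 1))),
        Complex.finrank_real_complex, finrank_euclideanSpace_fin, finrank_euclideanSpace_fin]
      ring
    smooth_z := contDiffOn_zChart he hf.smooth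
    smooth_θ := S.smooth_θ e he
    smooth_J := S.smooth_J e he
    dθ := fun _ hx => hf.dForm_formInChart he hx
    θ_ξ := fun x hx => (hξ x hx).1
    z_ξ := fun x hx => (hξ x hx).2
    θ_J := fun _ hx v _ => S.formInChart_endoInChart he hx v
    z_J := fun _ hx _ hv => hf.fderiv_zChart_endoInChart he hx hv
    orth := fun _ hx _ hv => hν.inner_fderiv_zChart hf he hx hv
    inj := fun _ hx _ hv => hν.eq_zero_of_fderiv_zChart hf he hx (hν0 _) hv }⟩

end FundamentalVectorField

section TangentFields

variable {E : Type*} [NormedAddCommGroup E] [NormedSpace ℝ E]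
  {W : Type*} [NormedAddCommGroup W] [InnerProductSpace ℂ W] [NormedSpace ℝ W]
  {V : Set E} {θ : E → E →L[ℝ] ℝ} {J : E → E →L[ℝ] E} {z w : E → W} {ξ : E → E} {x : E}

theorem inner_dbar {g : E → W} (hw : DifferentiableAt ℝ w x)
    (hg : DifferentiableAt ℝ g x) (hwg : ∀ᶠ y in 𝓝 x, ⟪w y, g y⟫_ℂ = 0) (v : E) :
    ⟪dbar J w x v, g x⟫_ℂ = -⟪w x, fderiv ℝ g x v - Complex.I • fderiv ℝ g x (J x v)⟫_ℂ := by
  rw [dbar, inner_add_left, inner_smul_left, inner_sub_right, inner_smul_right, Complex.conj_I,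
    inner_fderiv_of_const hw hg hwg, inner_fderiv_of_const hw hg hwg]
  ring

theorem IsContactHypersurface.exists_contDiffOn_inner_eq_zero [FiniteDimensional ℝ E]
    [IsScalarTower ℝ ℂ W] (H : IsContactHypersurface V θ J z w ξ) {h : W}
    (hh : ⟪w x, h⟫_ℂ = 0) :
    ∃ g : E → W, ContDiffOn ℝ ∞ g V ∧ (∀ y ∈ V, ⟪w y, g y⟫_ℂ = 0) ∧ g x = h := by
  have hcoeff : ContDiffOn ℝ ∞ (fun y => ⟪w y, h⟫_ℂ / ((‖w y‖ ^ 2 : ℝ) : ℂ)) V := by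
    simp only [div_eq_mul_inv]
    exact (H.smooth_w.inner ℂ contDiffOn_const).mul ((Complex.ofRealCLM.contDiff.comp_contDiffOn
      (H.smooth_w.norm_sq ℂ)).inv fun y hy => H.norm_sq_ne hy)
  refine ⟨fun y => h - (⟪w y, h⟫_ℂ / ((‖w y‖ ^ 2 : ℝ) : ℂ)) • w y,
    contDiffOn_const.sub (hcoeff.smul H.smooth_w), fun y hy => ?_, by simp [hh]⟩
  rw [inner_sub_right, inner_smul_right, inner_self_eq_ofReal,
    div_mul_cancel₀ _ (H.norm_sq_ne hy), sub_self]

end TangentFields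

section TorsionAndSecondFundamentalForm

variable {m : ℕ} {M : Type*} [TopologicalSpace M] [ChartedSpace (PHModel m) M]
  [IsManifold 𝓘(ℝ, PHModel m) ∞ M] {S : PseudohermitianStructure m M} {f ν : M → Heis (m + 1)}

/-- The `ℂⁿ`-component of `ν` is a CR map: it is annihilated by the `(0,1)`-part of `ker θ ⊗ ℂ`. -/
def IsCRField {n : ℕ} (S : PseudohermitianStructure m M) (ν : M → Heis n) : Prop :=
  ∀ e ∈ IsManifold.maximalAtlas 𝓘(ℝ, PHModel m) ∞ M, ∀ x ∈ e.target, ∀ v,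
    formInChart e S.θ x v = 0 → dbar (endoInChart e S.J) (zChart e ν) x v = 0

theorem exists_mem_maximalAtlas (p : M) : ∃ e ∈ IsManifold.maximalAtlas 𝓘(ℝ, PHModel m) ∞ M,
    ∃ x ∈ e.target, p ∈ e.source ∧ e p = x ∧ e.symm x = p :=
  ⟨_, IsManifold.chart_mem_maximalAtlas p, chartAt _ p p, mem_chart_target _ p,
    mem_chart_source _ p, rfl, (chartAt _ p).left_inv (mem_chart_source _ p)⟩

variable (hf : IsPseudohermitianSubmanifold S f) (hν : IsFundamentalVectorField S f ν)
  (hν0 : ∀ p, ν p ≠ 0)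

include hf hν hν0

theorem torsionVanishes_iff : TorsionVanishes S ↔ IsCRField S ν := by
  constructor
  · intro hT e he x hx
    obtain ⟨ξ, H⟩ := exists_isContactHypersurface he hf hν hν0
    obtain ⟨V, hVe, hV, hxV, ϑ, hϑ⟩ := H.exists_isAdmissibleCoframe hx
    obtain ⟨φ, A, hφ⟩ := (H.mono hV hVe).exists_isConnection hϑ
    exact ((H.mono hV hVe).torsion_eq_zero_iff hϑ hφ hxV).1 (hT e he V hV hVe ϑ φ A hϑ hφ x hxV)
  · intro hD e he V hV hVe ϑ φ A hϑ hφ x hx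
    obtain ⟨ξ, H⟩ := exists_isContactHypersurface he hf hν hν0
    exact ((H.mono hV hVe).torsion_eq_zero_iff hϑ hφ hx).2 (hD e he x (hVe hx))

section Chart

variable {e : OpenPartialHomeomorph M (PHModel m)}
  (he : e ∈ IsManifold.maximalAtlas 𝓘(ℝ, PHModel m) ∞ M) {x : PHModel m} (hx : x ∈ e.target)

include he hx

theorem holTangent_eq : holTangent S f (e.symm x) = (ℂ ∙ zChart e ν x)ᗮ := by
  obtain ⟨ξ, H⟩ := exists_isContactHypersurface he hf hν hν0
  apply le_antisymm
  · refine Submodule.span_le.2 ?_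
    rintro _ ⟨v, hv, rfl⟩
    rw [SetLike.mem_coe, Submodule.mem_orthogonal_singleton_iff_inner_right]
    rw [← chartLift_chartCoord he hx v] at hv ⊢
    rw [diffAt_chartLift he hf.smooth hx]
    exact H.orth x hx _ hv
  · intro h hh
    rw [Submodule.mem_orthogonal_singleton_iff_inner_right] at hh
    obtain ⟨v, hv, rfl⟩ := H.surj hx hh
    exact Submodule.subset_span ⟨chartLift e x v, hv, by rw [diffAt_chartLift he hf.smooth hx]⟩

theorem mem_holTangent_iff {h : EuclideanSpace ℂ (Fin (m + 1))} :
    h ∈ holTangent S f (e.symm x) ↔ ⟪zChart e ν x, h⟫_ℂ = 0 := by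
  rw [holTangent_eq hf hν hν0 he hx, Submodule.mem_orthogonal_singleton_iff_inner_right]

theorem secondFundamentalForm_eq_zero_iff {W : M → EuclideanSpace ℂ (Fin (m + 1))}
    (hW : MDifferentiableAt 𝓘(ℝ, PHModel m) 𝓘(ℝ, EuclideanSpace ℂ (Fin (m + 1))) W (e.symm x))
    (hW_tangent : ∀ᶠ y in 𝓝 x, W (e.symm y) ∈ holTangent S f (e.symm y)) (v : PHModel m) :
    secondFundamentalForm S f (e.symm x) (chartLift e x v) W = 0
      ↔ ⟪dbar (endoInChart e S.J) (zChart e ν) x v, W (e.symm x)⟫_ℂ = 0 := by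
  obtain ⟨ξ, H⟩ := exists_isContactHypersurface he hf hν hν0
  have hWe : DifferentiableAt ℝ (W ∘ e.symm) x := mdifferentiableAt_iff_differentiableAt.1
    (hW.comp x ((mdifferentiable_of_mem_maximalAtlas he).mdifferentiableAt_symm hx))
  have hwW : ∀ᶠ y in 𝓝 x, ⟪zChart e ν y, (W ∘ e.symm) y⟫_ℂ = 0 := by
    filter_upwards [hW_tangent, H.eventually_mem hx] with y hy hye
    exact (mem_holTangent_iff hf hν hν0 he hye).1 hy
  have hII : secondFundamentalForm S f (e.symm x) (chartLift e x v) W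
      = (holTangent S f (e.symm x))ᗮ.starProjection ((1 / 2 : ℂ) •
        (fderiv ℝ (W ∘ e.symm) x v
          - Complex.I • fderiv ℝ (W ∘ e.symm) x (endoInChart e S.J x v))) := by
    rw [fderiv_comp_symm he hx hW, fderiv_comp_symm he hx hW, chartLift_endoInChart he hx]
    rfl
  rw [hII, Submodule.starProjection_apply_eq_zero_iff, Submodule.orthogonal_orthogonal,
    mem_holTangent_iff hf hν hν0 he hx, inner_smul_right, mul_eq_zero, or_iff_right (by norm_num),
    ← Function.comp_apply (f := W), inner_dbar (H.differentiableAt hx H.smooth_w) hWe hwW,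
    neg_eq_zero]

theorem exists_tangent_field {h : EuclideanSpace ℂ (Fin (m + 1))}
    (hh : ⟪zChart e ν x, h⟫_ℂ = 0) :
    ∃ W : M → EuclideanSpace ℂ (Fin (m + 1)),
      ContMDiffOn 𝓘(ℝ, PHModel m) 𝓘(ℝ, EuclideanSpace ℂ (Fin (m + 1))) ∞ W e.source ∧
      (∀ q ∈ e.source, W q ∈ holTangent S f q) ∧ W (e.symm x) = h := by
  obtain ⟨ξ, H⟩ := exists_isContactHypersurface he hf hν hν0
  obtain ⟨g, hg, hwg, hgx⟩ := H.exists_contDiffOn_inner_eq_zero hh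
  refine ⟨g ∘ e, (contMDiffOn_iff_contDiffOn.2 hg).comp (contMDiffOn_of_mem_maximalAtlas he)
    fun p hp => e.map_source hp, fun q hq => ?_, by rw [Function.comp_apply, e.right_inv hx, hgx]⟩
  have h := (mem_holTangent_iff hf hν hν0 he (e.map_source hq)).2 (hwg _ (e.map_source hq))
  rwa [e.left_inv hq] at h

end Chart

theorem isCRField_of_secondFundamentalFormVanishes (hII : SecondFundamentalFormVanishes S f) :
    IsCRField S ν := by
  intro e he x hx v hv
  obtain ⟨ξ, H⟩ := exists_isContactHypersurface he hf hν hν0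
  obtain ⟨W, hW, hW_tangent, hWx⟩ :=
    exists_tangent_field hf hν hν0 he hx (H.inner_w_dbar hx hv)
  have h := hII e.source W e.open_source hW hW_tangent (e.symm x) (e.map_target hx)
    (chartLift e x v) hv
  rw [secondFundamentalForm_eq_zero_iff hf hν hν0 he hx, hWx] at h
  · exact inner_self_eq_zero.1 h
  · exact (hW.contMDiffAt (e.open_source.mem_nhds (e.map_target hx))).mdifferentiableAt (by simp)
  · filter_upwards [H.eventually_mem hx] with y hy using hW_tangent _ (e.map_target hy)

theorem secondFundamentalFormVanishes_iff : SecondFundamentalFormVanishes S f ↔ IsCRField S ν := by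
  refine ⟨isCRField_of_secondFundamentalFormVanishes hf hν hν0, ?_⟩
  intro hD U W hU hW hW_tangent p hp v hv
  obtain ⟨e, he, x, hx, -, -, rfl⟩ := exists_mem_maximalAtlas (m := m) p
  rw [← chartLift_chartCoord he hx v] at hv ⊢
  rw [secondFundamentalForm_eq_zero_iff hf hν hν0 he hx, hD e he x hx _ hv, inner_zero_left]
  · exact (hW.contMDiffAt (hU.mem_nhds hp)).mdifferentiableAt (by simp)
  · filter_upwards [(e.continuousAt_symm hx).preimage_mem_nhds (hU.mem_nhds hp)] with y hy
      using hW_tangent _ hy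

theorem torsionVanishes_iff_secondFundamentalFormVanishes :
    TorsionVanishes S ↔ SecondFundamentalFormVanishes S f :=
  (torsionVanishes_iff hf hν hν0).trans (secondFundamentalFormVanishes_iff hf hν hν0).symm

end TorsionAndSecondFundamentalForm

section WebsterCurvature

variable {m : ℕ} {M : Type*} [TopologicalSpace M] [ChartedSpace (PHModel m) M]
  [IsManifold 𝓘(ℝ, PHModel m) ∞ M] {S : PseudohermitianStructure m M} {f ν : M → Heis (m + 1)}

theorem isWebsterCurvatureAt_iff (hf : IsPseudohermitianSubmanifold S f)
    (hν : IsFundamentalVectorField S f ν) (hν0 : ∀ p, ν p ≠ 0) (hD : IsCRField S ν) (p : M)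
    (r : ℝ) : IsWebsterCurvatureAt S p r ↔ r = m * (m + 1) * ‖(ν p).1‖ ^ 2 := by
  constructor
  · rintro ⟨e, he, hp, V, hV, hVe, hpV, ϑ, φ, A, R, hϑ, hφ, hR, hr⟩
    obtain ⟨ξ, H⟩ := exists_isContactHypersurface he hf hν hν0
    have h := (H.mono hV hVe).sum_curvature hϑ hφ hpV hR fun y hy => hD e he y (hVe hy)
    rw [← hr, zChart, e.left_inv hp] at h
    exact_mod_cast h
  · rintro rfl
    obtain ⟨e, he, x, hx, hp, rfl, -⟩ := exists_mem_maximalAtlas (m := m) p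
    obtain ⟨ξ, H⟩ := exists_isContactHypersurface he hf hν hν0
    obtain ⟨V, hVe, hV, hxV, ϑ, hϑ⟩ := H.exists_isAdmissibleCoframe hx
    have H' := H.mono hV hVe
    have hDV := fun y (hy : y ∈ V) => hD e he y (hVe hy)
    obtain ⟨φ, A, hφ, hR⟩ := H'.exists_isCurvature hϑ hDV
    refine ⟨e, he, hp, V, hV, hVe, hxV, ϑ, φ, A, _, hϑ, hφ, hR, ?_⟩
    rw [H'.sum_curvature hϑ hφ hxV hR hDV, zChart, e.left_inv hp]

end WebsterCurvature

section LocalHomeomorph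

theorem isLocalHomeomorph_of_injective_fderiv {X : Type*} [TopologicalSpace X]
    {E : Type*} [NormedAddCommGroup E] [NormedSpace ℝ E] [FiniteDimensional ℝ E]
    {F : Type*} [NormedAddCommGroup F] [NormedSpace ℝ F] [FiniteDimensional ℝ F]
    (hdim : Module.finrank ℝ E = Module.finrank ℝ F) {g : X → F}
    (hg : ∀ p, ∃ e : OpenPartialHomeomorph X E, p ∈ e.source ∧
      ContDiffAt ℝ 1 (g ∘ e.symm) (e p) ∧ ∀ v, fderiv ℝ (g ∘ e.symm) (e p) v = 0 → v = 0) :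
    IsLocalHomeomorph g := by
  have : CompleteSpace E := FiniteDimensional.complete ℝ E
  refine IsLocalHomeomorph.mk g fun p => ?_
  obtain ⟨e, hp, hge, hinj⟩ := hg p
  let L := (LinearEquiv.ofInjectiveOfFinrankEq (fderiv ℝ (g ∘ e.symm) (e p) : E →ₗ[ℝ] F)
    ((injective_iff_map_eq_zero _).2 hinj) hdim).toContinuousLinearEquiv
  have hL : (L : E →L[ℝ] F) = fderiv ℝ (g ∘ e.symm) (e p) := ContinuousLinearMap.ext fun _ => rfl
  have hstrict : HasStrictFDerivAt (g ∘ e.symm) (L : E →L[ℝ] F) (e p) :=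
    hL ▸ hge.hasStrictFDerivAt one_ne_zero
  refine ⟨e.trans (hstrict.toOpenPartialHomeomorph _),
    ⟨hp, hstrict.mem_toOpenPartialHomeomorph_source⟩, fun q hq => ?_⟩
  exact (congrArg g (e.left_inv hq.1)).symm

/- The cone over `i ∘ F`, unlike `i ∘ F`, is a map between manifolds of the same dimension. -/
theorem isLocalHomeomorph_of_exp_smul {X Y W : Type*} [TopologicalSpace X] [TopologicalSpace Y]
    [NormedAddCommGroup W] [NormedSpace ℝ W] {i : Y → W} (hi : Continuous i)
    (hi_inj : Function.Injective i) {r : ℝ} (hr : r ≠ 0) (hnorm : ∀ y, ‖i y‖ = r) {F : X → Y}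
    (hF : Continuous F) (hcone : IsLocalHomeomorph fun q : X × ℝ => Real.exp q.2 • i (F q.1)) :
    IsLocalHomeomorph F := by
  have hopen : IsOpenMap F := fun U hU => by
    convert (hcone.isOpenMap _ (hU.prod isOpen_univ)).preimage hi using 1
    ext y
    constructor
    · rintro ⟨p, hp, rfl⟩
      exact ⟨(p, 0), ⟨hp, mem_univ _⟩, by simp⟩
    · rintro ⟨⟨p, s⟩, ⟨hp, -⟩, hps⟩
      have hs := congrArg norm hps
      rw [norm_smul, hnorm, hnorm, Real.norm_of_nonneg (Real.exp_pos s).le,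
        mul_eq_right₀ hr, Real.exp_eq_one_iff] at hs
      exact ⟨p, hp, hi_inj (by simpa [hs] using hps)⟩
  rw [isLocalHomeomorph_iff_isOpenEmbedding_restrict]
  intro p
  obtain ⟨G, hpG, hG⟩ := hcone (p, 0)
  have hslice : Continuous fun q : X => (q, (0 : ℝ)) := by fun_prop
  have hU := G.open_source.preimage hslice
  refine ⟨_, hU.mem_nhds hpG, IsOpenEmbedding.of_continuous_injective_isOpenMap
    (hF.comp continuous_subtype_val) (fun q₁ q₂ hq => ?_) (hopen.comp hU.isOpenMap_subtype_val)⟩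
  have hFq : F q₁ = F q₂ := hq
  have hGq : G (q₁, 0) = G (q₂, 0) := by rw [← hG]; simp only [hFq]
  exact Subtype.ext (Prod.ext_iff.1 (G.injOn q₁.2 q₂.2 hGq)).1

end LocalHomeomorph

section Cone

variable {E : Type*} [NormedAddCommGroup E] [NormedSpace ℝ E]
  {W : Type*} [NormedAddCommGroup W] [NormedSpace ℝ W] {V : Set E} {z w : E → W} {x : E}

theorem fderiv_exp_smul (hz : DifferentiableAt ℝ z x) (s : ℝ) (v : E) (a : ℝ) :
    fderiv ℝ (fun y : E × ℝ => Real.exp y.2 • z y.1) (x, s) (v, a)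
      = Real.exp s • (fderiv ℝ z x v + a • z x) := by
  have hexp : HasFDerivAt (fun y : E × ℝ => Real.exp y.2)
      (Real.exp s • ContinuousLinearMap.snd ℝ E ℝ) (x, s) :=
    (hasFDerivAt_snd (𝕜 := ℝ) (p := (x, s))).exp
  have hz_fst : HasFDerivAt (fun y : E × ℝ => z y.1)
      ((fderiv ℝ z x).comp (ContinuousLinearMap.fst ℝ E ℝ)) (x, s) :=
    HasFDerivAt.comp (f := Prod.fst) (x, s) hz.hasFDerivAt hasFDerivAt_fst
  rw [(hexp.fun_smul hz_fst).fderiv]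
  simp [smul_smul]

namespace IsContactHypersurface

variable [InnerProductSpace ℂ W] {θ : E → E →L[ℝ] ℝ} {J : E → E →L[ℝ] E} {ξ : E → E}
  (H : IsContactHypersurface V θ J z w ξ) (hx : x ∈ V)

include H hx

variable [IsScalarTower ℝ ℂ W] {z₀ : W} (hz₀ : w x = (‖w x‖ ^ 2) • Complex.I • (z x - z₀))

include hz₀

theorem sub_center_eq : z x - z₀ = (-(‖w x‖ ^ 2)⁻¹) • Complex.I • w x := by
  have hw : ‖w x‖ ^ 2 ≠ 0 := pow_ne_zero 2 (norm_ne_zero_iff.2 (H.w_ne hx))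
  have h := congrArg (fun a => (‖w x‖ ^ 2)⁻¹ • a) hz₀
  simp only [inv_smul_smul₀ hw] at h
  rw [neg_smul, ← smul_comm Complex.I, h, smul_smul, Complex.I_mul_I, neg_one_smul, neg_neg]

theorem norm_sub_center : ‖z x - z₀‖ = 1 / ‖w x‖ := by
  have hw : ‖w x‖ ≠ 0 := norm_ne_zero_iff.2 (H.w_ne hx)
  rw [H.sub_center_eq hx hz₀, norm_smul, norm_smul, Complex.norm_I, norm_neg, norm_inv, norm_pow,
    norm_norm]
  field_simp

theorem im_inner_sub_center (v : E) : (⟪z x - z₀, fderiv ℝ z x v⟫_ℂ).im = θ x v := by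
  have hw : ‖w x‖ ≠ 0 := norm_ne_zero_iff.2 (H.w_ne hx)
  have h : ⟪Complex.I • w x, fderiv ℝ z x v⟫_ℂ
      = -Complex.I * ((‖w x‖ ^ 2 * θ x v : ℝ) : ℂ) := by
    rw [inner_smul_left, Complex.conj_I, H.inner_w_dz hx]
  rw [H.sub_center_eq hx hz₀, inner_smul_left_eq_smul, h, Complex.smul_im, neg_mul, Complex.neg_im,
    Complex.I_mul_im, Complex.ofReal_re, smul_eq_mul]
  field_simp

theorem eq_zero_of_fderiv_exp_smul (s : ℝ) {u : E × ℝ}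
    (hu : fderiv ℝ (fun y : E × ℝ => Real.exp y.2 • (z y.1 - z₀)) (x, s) u = 0) : u = 0 := by
  obtain ⟨v, a⟩ := u
  have hw : -(‖w x‖ ^ 2)⁻¹ ≠ 0 :=
    neg_ne_zero.2 (inv_ne_zero (pow_ne_zero 2 (norm_ne_zero_iff.2 (H.w_ne hx))))
  rw [fderiv_exp_smul (z := fun y => z y - z₀) ((H.differentiableAt hx H.smooth_z).sub_const z₀),
    smul_eq_zero, or_iff_right (Real.exp_ne_zero s), fderiv_sub_const, H.sub_center_eq hx hz₀,
    smul_smul] at hu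
  obtain ⟨-, ha⟩ := apply_eq_zero_of_add_smul_I_eq (H.w_ne hx) (H.inner_w_dz hx)
    (inner_zero_right _) hu
  rw [ha, zero_smul, add_zero] at hu
  rw [H.inj x hx v hu, (mul_eq_zero.1 ha).resolve_right hw, Prod.mk_zero_zero]

end IsContactHypersurface

end Cone

section Rigidity

theorem IsContactHypersurface.exists_ne_zero {E : Type*} [NormedAddCommGroup E] [NormedSpace ℝ E]
    [FiniteDimensional ℝ E] {W : Type*} [NormedAddCommGroup W] [InnerProductSpace ℂ W]
    [NormedSpace ℝ W] [IsScalarTower ℝ ℂ W] {V : Set E} {θ : E → E →L[ℝ] ℝ} {J : E → E →L[ℝ] E}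
    {z w : E → W} {ξ : E → E} (H : IsContactHypersurface V θ J z w ξ) {x : E} (hx : x ∈ V)
    (hdim : 1 < Module.finrank ℂ W) : ∃ v, θ x v = 0 ∧ v ≠ 0 := by
  obtain ⟨k, hk⟩ := Nat.exists_eq_add_of_lt hdim
  obtain ⟨g, hg, hwg⟩ := exists_orthonormal_inner_eq_zero (m := k + 1) (by omega) (H.w_ne hx)
  obtain ⟨v, hv, hvg⟩ := H.surj hx (hwg 0)
  refine ⟨v, hv, fun h0 => hg.ne_zero 0 ?_⟩
  rw [← hvg, h0, map_zero]

variable {m : ℕ} {M : Type*} [TopologicalSpace M] [ChartedSpace (PHModel m) M]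
  [IsManifold 𝓘(ℝ, PHModel m) ∞ M]

theorem eq_of_fderiv_comp_symm_eq_zero [PreconnectedSpace M] {F : Type*} [NormedAddCommGroup F]
    [NormedSpace ℝ F] {φ : M → F}
    (h : ∀ e ∈ IsManifold.maximalAtlas 𝓘(ℝ, PHModel m) ∞ M,
      ContDiffOn ℝ ∞ (φ ∘ e.symm) e.target ∧ ∀ x ∈ e.target, fderiv ℝ (φ ∘ e.symm) x = 0)
    (p q : M) : φ p = φ q := by
  refine IsLocallyConstant.apply_eq_of_preconnectedSpace ?_ p q
  rw [IsLocallyConstant.iff_eventually_eq]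
  intro p
  obtain ⟨e, he, x, hx, hp, rfl, hpx⟩ := exists_mem_maximalAtlas (m := m) p
  obtain ⟨hφ, hφ0⟩ := h e he
  obtain ⟨ε, hε, hball⟩ := Metric.isOpen_iff.1 e.open_target (e p) hx
  filter_upwards [(e.continuousAt hp).preimage_mem_nhds (Metric.ball_mem_nhds (e p) hε),
    e.open_source.mem_nhds hp] with q hq hqs
  have hconst := Metric.isOpen_ball.is_const_of_fderiv_eq_zero (𝕜 := ℝ)
    (convex_ball (e p) ε).isPreconnected ((hφ.mono hball).differentiableOn (by simp))
    (fun y hy => hφ0 y (hball hy)) hq (Metric.mem_ball_self hε)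
  simpa [e.left_inv hqs, hpx] using hconst

theorem IsFundamentalVectorField.length_eq {n : ℕ} {S : PseudohermitianStructure m M}
    {f ν : M → Heis n} (hν : IsFundamentalVectorField S f ν) (p : M) :
    Heis.length (f p) (ν p) = ‖(ν p).1‖ := by
  rw [Heis.length, Heis.metric, (hν p).1, zero_mul, add_zero, inner_self_eq_ofReal,
    Complex.ofReal_re, Real.sqrt_sq (norm_nonneg _)]

variable {S : PseudohermitianStructure m M} {f ν : M → Heis (m + 1)}
  (hf : IsPseudohermitianSubmanifold S f) (hν : IsFundamentalVectorField S f ν)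
  (hν0 : ∀ p, ν p ≠ 0)

include hf hν hν0

section CR

variable (hm : 1 ≤ m) (hD : IsCRField S ν)

include hm hD

theorem norm_fst_eq [PreconnectedSpace M] (p q : M) : ‖(ν p).1‖ = ‖(ν q).1‖ := by
  suffices h : ∀ p q, ‖(ν p).1‖ ^ 2 = ‖(ν q).1‖ ^ 2 from
    (sq_eq_sq₀ (norm_nonneg _) (norm_nonneg _)).1 (h p q)
  refine eq_of_fderiv_comp_symm_eq_zero (m := m) fun e he => ?_
  obtain ⟨ξ, H⟩ := exists_isContactHypersurface he hf hν hν0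
  refine ⟨H.smooth_w.norm_sq ℂ, fun x hx => ?_⟩
  obtain ⟨v, hv, hv0⟩ := H.exists_ne_zero hx (by simpa using Nat.succ_le_iff.1 hm)
  exact H.fderiv_norm_sq_eq_zero hx (hD e he) hv hv0

theorem exists_center [ConnectedSpace M] :
    ∃ z₀, ∀ p, (ν p).1 = (‖(ν p).1‖ ^ 2) • Complex.I • ((f p).1 - z₀) := by
  have hconst : ∀ p q, (ν p).1 - (‖(ν p).1‖ ^ 2) • Complex.I • (f p).1
      = (ν q).1 - (‖(ν q).1‖ ^ 2) • Complex.I • (f q).1 := by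
    refine eq_of_fderiv_comp_symm_eq_zero (m := m) fun e he => ?_
    obtain ⟨ξ, H⟩ := exists_isContactHypersurface he hf hν hν0
    exact ⟨H.smooth_w.sub ((H.smooth_w.norm_sq ℂ).smul (H.smooth_z.const_smul Complex.I)),
      fun x hx => H.fderiv_sub_eq_zero hx (hD e he)
        fun y hy => H.exists_ne_zero hy (by simpa using Nat.succ_le_iff.1 hm)⟩
  obtain ⟨p₀⟩ := ‹ConnectedSpace M›.toNonempty
  set a := (ν p₀).1 - (‖(ν p₀).1‖ ^ 2) • Complex.I • (f p₀).1 with ha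
  refine ⟨Complex.I • (‖(ν p₀).1‖ ^ 2)⁻¹ • a, fun p => ?_⟩
  have hc : ‖(ν p₀).1‖ ^ 2 ≠ 0 := pow_ne_zero 2 (norm_ne_zero_iff.2 (hν.fst_ne_zero (hν0 p₀)))
  rw [smul_sub, smul_smul Complex.I, Complex.I_mul_I, smul_sub, neg_one_smul, smul_neg,
    norm_fst_eq hf hν hν0 hm hD p p₀, smul_inv_smul₀ hc, ha, ← hconst p p₀,
    norm_fst_eq hf hν hν0 hm hD p p₀]
  abel

end CR

variable {z₀ : EuclideanSpace ℂ (Fin (m + 1))}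
  (hz₀ : ∀ p, (ν p).1 = (‖(ν p).1‖ ^ 2) • Complex.I • ((f p).1 - z₀))

include hz₀

theorem snd_add_im_inner_eq [PreconnectedSpace M] (p q : M) :
    (f p).2 + (⟪z₀, (f p).1⟫_ℂ).im = (f q).2 + (⟪z₀, (f q).1⟫_ℂ).im := by
  refine eq_of_fderiv_comp_symm_eq_zero (m := m)
    (φ := fun p => (f p).2 + (⟪z₀, (f p).1⟫_ℂ).im) (fun e he => ?_) p q
  obtain ⟨ξ, H⟩ := exists_isContactHypersurface he hf hν hν0
  have ht := contDiffOn_tChart he hf.smooth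
  let L : EuclideanSpace ℂ (Fin (m + 1)) →L[ℝ] ℝ :=
    Complex.imCLM.comp ((innerSL ℂ z₀).restrictScalars ℝ)
  change ContDiffOn ℝ ∞ (fun y => tChart e f y + L (zChart e f y)) e.target ∧
    ∀ x ∈ e.target, fderiv ℝ (fun y => tChart e f y + L (zChart e f y)) x = 0
  refine ⟨ht.add (L.contDiff.comp_contDiffOn H.smooth_z), fun x hx => ?_⟩
  have hderiv := (H.differentiableAt hx ht).hasFDerivAt.fun_add
    (L.hasFDerivAt.comp x (H.differentiableAt hx H.smooth_z).hasFDerivAt)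
  refine hderiv.fderiv.trans (ContinuousLinearMap.ext fun v => ?_)
  have hθ := hf.formInChart_eq he hx v
  rw [← H.im_inner_sub_center hx (hz₀ _), inner_sub_left, Complex.sub_im] at hθ
  change fderiv ℝ (tChart e f) x v + (⟪z₀, fderiv ℝ (zChart e f) x v⟫_ℂ).im = 0
  linarith

omit hz₀ in
theorem norm_fst_sub_center {p : M}
    (hz₀ : (ν p).1 = (‖(ν p).1‖ ^ 2) • Complex.I • ((f p).1 - z₀)) :
    ‖(f p).1 - z₀‖ = 1 / ‖(ν p).1‖ := by
  obtain ⟨e, he, x, hx, -, -, rfl⟩ := exists_mem_maximalAtlas (m := m) p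
  obtain ⟨ξ, H⟩ := exists_isContactHypersurface he hf hν hν0
  exact H.norm_sub_center hx hz₀

theorem isLocalHomeomorph_cone :
    IsLocalHomeomorph fun q : M × ℝ => Real.exp q.2 • ((f q.1).1 - z₀) := by
  refine isLocalHomeomorph_of_injective_fderiv (E := PHModel m × ℝ) ?_ fun ⟨p, s⟩ => ?_
  · rw [← Module.finrank_mul_finrank ℝ ℂ (EuclideanSpace ℂ (Fin (m + 1))),
      Complex.finrank_real_complex, Module.finrank_prod, finrank_euclideanSpace_fin,
      finrank_euclideanSpace_fin, Module.finrank_self]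
    ring
  obtain ⟨e, he, x, hx, hp, rfl, -⟩ := exists_mem_maximalAtlas (m := m) p
  obtain ⟨ξ, H⟩ := exists_isContactHypersurface he hf hν hν0
  have hz : ContDiffAt ℝ 1 (zChart e f) (e p) := (H.contDiffAt hx H.smooth_z).of_le one_le_two
  exact ⟨e.prod (OpenPartialHomeomorph.refl ℝ), ⟨hp, mem_univ s⟩,
    (Real.contDiff_exp.contDiffAt.comp (e p, s) contDiffAt_snd).smul
      ((hz.comp (e p, s) contDiffAt_fst).sub contDiffAt_const),
    fun u hu => H.eq_zero_of_fderiv_exp_smul hx (hz₀ _) s hu⟩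

theorem isLocalHomeomorph_sphere {r : ℝ} (hr : r ≠ 0) {F : M → Heis.sphere (m + 1) r}
    (hF : ∀ p, (F p : Heis (m + 1)) = ((f p).1 - z₀, 0)) : IsLocalHomeomorph F := by
  have hF_cont : Continuous F := by
    refine continuous_induced_rng.2 ((?_ : Continuous fun p => ((f p).1 - z₀, (0 : ℝ))).congr
      fun p => (hF p).symm)
    exact ((continuous_fst.comp hf.smooth.continuous).sub continuous_const).prodMk continuous_const
  refine isLocalHomeomorph_of_exp_smul (i := fun q : Heis.sphere (m + 1) r => (q : Heis (m + 1)).1)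
    (continuous_fst.comp continuous_subtype_val)
    (fun a b hab => Subtype.ext (Prod.ext hab (a.2.2.trans b.2.2.symm))) hr (fun q => q.2.1)
    hF_cont ?_
  simpa only [hF] using isLocalHomeomorph_cone hf hν hν0 hz₀

end Rigidity

namespace Heis

variable {n : ℕ}

theorem isRigidMotion_mul (p : Heis n) : IsRigidMotion (mul p) :=
  ⟨p, LinearIsometryEquiv.refl ℂ _, fun _ => rfl⟩

theorem mul_right_injective (p : Heis n) : Function.Injective (mul p) := by
  intro q q' h
  obtain ⟨hz, ht⟩ := Prod.ext_iff.1 h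
  have hz' : q.1 = q'.1 := add_left_cancel hz
  simp only [mul, hz'] at ht
  exact Prod.ext hz' (by linarith)

theorem neg_mul_eq {z₀ : EuclideanSpace ℂ (Fin n)} {τ : ℝ} {q : Heis n}
    (hq : q.2 + (⟪z₀, q.1⟫_ℂ).im = τ) : mul (-z₀, -τ) q = (q.1 - z₀, 0) := by
  refine Prod.ext (neg_add_eq_sub z₀ q.1) ?_
  simp only [mul, inner_neg_left, Complex.neg_im]
  linarith

end Heis

theorem theoremD_general (m : ℕ) (hm : 1 ≤ m) {M : Type*} [TopologicalSpace M]
    [ChartedSpace (PHModel m) M] [IsManifold 𝓘(ℝ, PHModel m) ∞ M] [ConnectedSpace M]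
    (S : PseudohermitianStructure m M) (f : M → Heis (m + 1))
    (hf : IsPseudohermitianSubmanifold S f)
    (ν : M → Heis (m + 1)) (hν : IsFundamentalVectorField S f ν) (hν0 : ∀ p, ν p ≠ 0) :
    (TorsionVanishes S ↔ SecondFundamentalFormVanishes S f) ∧
    (TorsionVanishes S → ∃ c : ℝ, 0 < c ∧
      (∀ p, Heis.length (f p) (ν p) = c) ∧
      (∀ (p : M) (r : ℝ), IsWebsterCurvatureAt S p r ↔ r = m * (m + 1) * c ^ 2) ∧
      ∃ Φ : Heis (m + 1) → Heis (m + 1), Heis.IsRigidMotion Φ ∧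
        ∃ F : M → Heis.sphere (m + 1) (1 / c), (∀ p, (F p : Heis (m + 1)) = Φ (f p)) ∧
          IsLocalHomeomorph F ∧
          (Function.Injective f → IsOpenEmbedding F)) := by
  refine ⟨torsionVanishes_iff_secondFundamentalFormVanishes hf hν hν0, fun hT => ?_⟩
  have hD := (torsionVanishes_iff hf hν hν0).1 hT
  obtain ⟨p₀⟩ := ‹ConnectedSpace M›.toNonempty
  have hnorm := fun p => norm_fst_eq hf hν hν0 hm hD p p₀
  have hc : 0 < ‖(ν p₀).1‖ := norm_pos_iff.2 (hν.fst_ne_zero (hν0 p₀))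
  obtain ⟨z₀, hz₀⟩ := exists_center hf hν hν0 hm hD
  have hΦ := fun p => Heis.neg_mul_eq (snd_add_im_inner_eq hf hν hν0 hz₀ p p₀)
  let F : M → Heis.sphere (m + 1) (1 / ‖(ν p₀).1‖) := fun p => ⟨Heis.mul _ (f p), by
    rw [hΦ p, ← hnorm p]
    exact ⟨norm_fst_sub_center hf hν hν0 (hz₀ p), rfl⟩⟩
  have hF := isLocalHomeomorph_sphere hf hν hν0 hz₀ (one_div_ne_zero hc.ne') (F := F) hΦ
  exact ⟨‖(ν p₀).1‖, hc, fun p => (hν.length_eq p).trans (hnorm p),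
    fun p r => hnorm p ▸ isWebsterCurvatureAt_iff hf hν hν0 hD p r, _, Heis.isRigidMotion_mul _,
    F, fun _ => rfl, hF, fun hf_inj => hF.isOpenEmbedding_of_injective fun _ _ h =>
      hf_inj (Heis.mul_right_injective _ (congrArg Subtype.val h))⟩

end

theorem theoremD (m : ℕ) (hm : 1 ≤ m) {M : Type*} [TopologicalSpace M]
    [ChartedSpace (PHModel m) M] [IsManifold 𝓘(ℝ, PHModel m) ∞ M] [SimplyConnectedSpace M]
    (S : PseudohermitianStructure m M) (f : M → Heis (m + 1))
    (hf : IsPseudohermitianSubmanifold S f)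
    (ν : M → Heis (m + 1)) (hν : IsFundamentalVectorField S f ν) (hν0 : ∀ p, ν p ≠ 0) :
    (TorsionVanishes S ↔ SecondFundamentalFormVanishes S f) ∧
    (TorsionVanishes S → ∃ c : ℝ, 0 < c ∧
      (∀ p, Heis.length (f p) (ν p) = c) ∧
      (∀ (p : M) (r : ℝ), IsWebsterCurvatureAt S p r ↔ r = m * (m + 1) * c ^ 2) ∧
      ∃ Φ : Heis (m + 1) → Heis (m + 1), Heis.IsRigidMotion Φ ∧
        ∃ F : M → Heis.sphere (m + 1) (1 / c), (∀ p, (F p : Heis (m + 1)) = Φ (f p)) ∧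
          IsLocalHomeomorph F ∧
          (Function.Injective f → IsOpenEmbedding F)) :=
  theoremD_general m hm S f hf ν hν hν0
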